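/- Let $\nu>3$ be real and let $S=V^{-1/2}$ with $V\sim\chi^2_\nu/\nu$ (where $\chi^2_\nu$ is the Gamma distribution with shape $\nu/2$ and rate $1/2$). Let $\xi,\alpha\in\mathbb{R}^p$, let $\Omega$ be a symmetric positive definite $p\times p$ matrix, $\omega=\mathrm{diag}(\sqrt{\Omega_{11}},\dots,\sqrt{\Omega_{pp}})$, $\bar\Omega=\omega^{-1}\Omega\omega^{-1}$ and $\eta=\omega^{-1}\alpha$. Let $X$ be a multivariate skew-$t$ vector, i.e. $X$ has the law of $\xi+\omega SZ$, where $Z$ is independent of $S$ and has the skew-normal density $2\phi_p(z;\bar\Omega)\Phi(\alpha'z)$ on $\mathbb{R}^p$; here $\phi_p(\cdot;\bar\Omega)$ is the $N_p(0,\bar\Omega)$ density and $\Phi$ is the standard normal distribution function. For a random variable $Y$ with mean $\mu_Y$ and standard deviation $\sigma_Y$ put $\gamma_1(Y)=\bigl(E[((Y-\mu_Y)/\sigma_Y)^3]\bigr)^2$. Then: 1. For every integer $k$ with $1\le k<\nu$, $S^k$ is integrable and $E(S^k)=\dfrac{(\nu/2)^{k/2}\,\Gamma((\nu-k)/2)}{\Gamma(\nu/2)}$.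 2. If $\nu\ge 4$ (in particular for every integer $\nu>3$), then $\frac{4}{\pi}E(S)^2\ge E(S^2)$. 3. The number $a=\frac4\pi E(S)^3-E(S^3)$ equals $$\nu E(S)\left(\frac2\pi\,\frac{\Gamma\left(\frac{\nu-1}{2}\right)^2}{\Gamma\left(\frac{\nu}{2}\right)^2}-\frac1{\nu-3}\right).$$ It is negative if $\nu\le 8$ and positive if $\nu\ge 9$; in particular, for integer $\nu>3$, it is negative for $\nu<9$ and positive for $\nu\ge 9$. 4. Every projection $d'X$ has a finite third absolute moment, and the covariance matrix $\Sigma$ of $X$ is positive definite. If $\alpha\neq0$, then the maximal-skewness direction of $X$ is that of $\eta$: the maximum of $\gamma_1(d'X)$ over all $d\in\mathbb{R}^p$ with $d'\Sigma d=1$ is attained at a multiple of $\eta$, and every maximizer is a multiple of $\eta$. -/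

import Mathlib

open MeasureTheory ProbabilityTheory Matrix
open scoped ENNReal

noncomputable section

namespace SkewT

/-- The `p`-dimensional normal density `φ_p(z; R)` with zero mean and covariance matrix `R`. -/
def normalDensity {p : ℕ} (R : Matrix (Fin p) (Fin p) ℝ) (z : Fin p → ℝ) : ℝ :=
  (√((2 * Real.pi) ^ p * R.det))⁻¹ * Real.exp (-(z ⬝ᵥ (R⁻¹ *ᵥ z)) / 2)

/-- The density `2 φ_p(z; R) Φ(α' z)` of a normalized skew-normal vector, where `R` is a correlation
matrix and `Φ` is the distribution function of `N(0, 1)`. -/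
def skewNormalDensity {p : ℕ} (R : Matrix (Fin p) (Fin p) ℝ) (α z : Fin p → ℝ) : ℝ :=
  2 * normalDensity R z * cdf (gaussianReal 0 1) (α ⬝ᵥ z)

/-- The normalized skew-normal distribution `SN_p(0, R, α)`, through its Lebesgue density. -/
def skewNormalMeasure {p : ℕ} (R : Matrix (Fin p) (Fin p) ℝ) (α : Fin p → ℝ) :
    Measure (Fin p → ℝ) :=
  volume.withDensity fun z => ENNReal.ofReal (skewNormalDensity R α z)

/-- The diagonal scale matrix `ω = (Ω ⊙ I)^{1/2}` of `Ω`. -/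
def scaleDiag {p : ℕ} (Om : Matrix (Fin p) (Fin p) ℝ) : Matrix (Fin p) (Fin p) ℝ :=
  Matrix.diagonal fun i => √(Om i i)

/-- The correlation matrix `ω⁻¹ Ω ω⁻¹` of `Ω`. -/
def corrMatrix {p : ℕ} (Om : Matrix (Fin p) (Fin p) ℝ) : Matrix (Fin p) (Fin p) ℝ :=
  (scaleDiag Om)⁻¹ * Om * (scaleDiag Om)⁻¹

/-- The shape vector `η = ω⁻¹ α`. -/
def shapeVector {p : ℕ} (Om : Matrix (Fin p) (Fin p) ℝ) (α : Fin p → ℝ) : Fin p → ℝ :=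
  (scaleDiag Om)⁻¹ *ᵥ α

/-- The scale mixture of skew-normals `SMSN_p(ξ, Ω, α, H)`: the law of `ξ + ω S Z`, where `S` has
law `H`, the vector `Z` has law `SN_p(0, ω⁻¹ Ω ω⁻¹, α)`, and `S` and `Z` are independent. -/
def smsnMeasure {p : ℕ} (ξ : Fin p → ℝ) (Om : Matrix (Fin p) (Fin p) ℝ) (α : Fin p → ℝ)
    (H : Measure ℝ) : Measure (Fin p → ℝ) :=
  (H.prod (skewNormalMeasure (corrMatrix Om) α)).map
    fun q => ξ + scaleDiag Om *ᵥ (q.1 • q.2)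

/-- The chi-squared distribution with `ν` degrees of freedom, which is the gamma distribution with
shape `ν / 2` and rate `1 / 2`. -/
def chiSquaredMeasure (ν : ℝ) : Measure ℝ := gammaMeasure (ν / 2) (1 / 2)

/-- The covariance matrix of a random vector. -/
def covMatrix {Ω : Type*} [MeasurableSpace Ω] {p : ℕ} (P : Measure Ω) (X : Ω → Fin p → ℝ) :
    Matrix (Fin p) (Fin p) ℝ :=
  Matrix.of fun i j => covariance (fun w => X w i) (fun w => X w j) P

/-- The skewness index `γ₁(Y) = (E[((Y - μ_Y) / σ_Y)³])²` of a random variable. -/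
def skewnessIndex {Ω : Type*} [MeasurableSpace Ω] (P : Measure Ω) (Y : Ω → ℝ) : ℝ :=
  (∫ w, ((Y w - ∫ v, Y v ∂P) / √(variance Y P)) ^ 3 ∂P) ^ 2

/-- The skewness index `γ₁(d' X)` of the projection of `X` onto `d`. -/
def directionalSkewness {Ω : Type*} [MeasurableSpace Ω] {p : ℕ} (P : Measure Ω)
    (X : Ω → Fin p → ℝ) (d : Fin p → ℝ) : ℝ :=
  skewnessIndex P fun w => d ⬝ᵥ X w

/-- The vectors `d` with `d' Σ d = 1`. -/
def unitVarianceDirections {p : ℕ} (Sig : Matrix (Fin p) (Fin p) ℝ) : Set (Fin p → ℝ) :=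
  {d | d ⬝ᵥ (Sig *ᵥ d) = 1}

/-- The maximizers of `γ₁(d' X)` over the vectors `d` with `d' Σ d = 1`, where `Σ` is the
covariance matrix of `X`. -/
def maxSkewnessDirections {Ω : Type*} [MeasurableSpace Ω] {p : ℕ} (P : Measure Ω)
    (X : Ω → Fin p → ℝ) : Set (Fin p → ℝ) :=
  {d | d ∈ unitVarianceDirections (covMatrix P X) ∧
    IsMaxOn (directionalSkewness P X) (unitVarianceDirections (covMatrix P X)) d}

/-- A random vector with the stochastic representation `X = ξ + ω S Z` has the law
`SMSN_p(ξ, Ω, α, H)`, where `H` is the law of `S`. -/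
theorem hasLaw_smsnMeasure {Ω : Type*} [MeasurableSpace Ω] {P : Measure Ω} [IsProbabilityMeasure P]
    {p : ℕ} {ξ : Fin p → ℝ} {Om : Matrix (Fin p) (Fin p) ℝ} {α : Fin p → ℝ}
    {S : Ω → ℝ} {Z : Ω → Fin p → ℝ} (hS : AEMeasurable S P)
    (hZ : HasLaw Z (skewNormalMeasure (corrMatrix Om) α) P) (hSZ : IndepFun S Z P) :
    HasLaw (fun w => ξ + scaleDiag Om *ᵥ (S w • Z w)) (smsnMeasure ξ Om α (P.map S)) P := by
  have hm : Measurable fun q : ℝ × (Fin p → ℝ) => ξ + scaleDiag Om *ᵥ (q.1 • q.2) :=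
    (continuous_const.add
      (continuous_const.matrix_mulVec (continuous_fst.smul continuous_snd))).measurable
  have hpair : AEMeasurable (fun w => (S w, Z w)) P := hS.prodMk hZ.aemeasurable
  have h := (indepFun_iff_map_prod_eq_prod_map_map hS hZ.aemeasurable).1 hSZ
  rw [hZ.map_eq] at h
  have hmap : HasLaw (fun w => (S w, Z w))
      ((P.map S).prod (skewNormalMeasure (corrMatrix Om) α)) P :=
    { aemeasurable := hpair, map_eq := h }
  have hlaw : HasLaw (fun q : ℝ × (Fin p → ℝ) => ξ + scaleDiag Om *ᵥ (q.1 • q.2))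
      (smsnMeasure ξ Om α (P.map S))
      ((P.map S).prod (skewNormalMeasure (corrMatrix Om) α)) :=
    { aemeasurable := hm.aemeasurable, map_eq := rfl }
  exact hlaw.fun_comp hmap

end SkewT

end

/-! Everything reduces to estimates on G(x) = Γ(x - 1/2)² / Γ(x)² at x = ν/2 and to the maximization
of a function of one variable.

Write s1, s2, s3 for the first three moments of S. Integrating against the chi-squared density turns
them into Gamma quotients, and Γ(x + 1) = x Γ(x) gives s1² = (ν/2) G(ν/2), s2 = ν/(ν - 2) and s3 =
s1 ν/(ν - 3). The moment condition becomes π/4 ≤ (x - 1) G(x), and a has the sign of (x - 3/2) G(x)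
- π/4. For c = 1 and c = 3/2 the function (x - c) G(x) is nondecreasing: its ratio under x ↦ x + 1
is an explicit decreasing rational function, and it tends to 1 (`le_of_ratio_antitone`). The claims
then follow from exact values at x = 2, 4 and 9/2, that is ν = 4, 8 and 9.

A skew-normal vector is a Gaussian Y conditioned on T ≤ α'Y (`skewNormalMeasure_eq`). A projection
of Y is a multiple of the standardized α'Y - T plus an independent Gaussian, so its conditional
moments come from half-line Gaussian moments. With u = ωd, R the correlation matrix, q = u'Ru, δ =
`projDelta R α u` and κ = √(2/π), the projection d'X has variance s2 q - κ² s1² δ² and third central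
moment κ δ (3 q (s3 - s1 s2) + a δ²).

On the constraint set the variance is 1, which eliminates q: the skewness index is κ² t (A + B t)²
with t = δ² and A > 0. Here a may be negative, but B exceeds a by a positive term, and
`pi_lt_mul_gammaRatioSq` gives B ≥ 0 for every ν > 3. So the index strictly increases in t, and
Cauchy–Schwarz for R shows that t is largest exactly when ωd is parallel to α, that is d parallel to
η. The sign of a plays no role here. -/

noncomputable section

/-! ### Bounds and monotonicity for the squared Gamma ratio -/

namespace SkewT

open Filter Topology

/-- A positive function on `(a, ∞)` with a positive limit along integer translates, whose ratio of
consecutive values `f (x + 1) / f x` is antitone, is monotone. -/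
theorem le_of_ratio_antitone {f : ℝ → ℝ} {a L : ℝ} (hpos : ∀ x, a < x → 0 < f x)
    (hstep : ∀ x y, a < x → x ≤ y → f x * f (y + 1) ≤ f y * f (x + 1)) (hL : 0 < L)
    (hlim : ∀ x, a < x → Tendsto (fun n : ℕ => f (x + n)) atTop (𝓝 L))
    {x y : ℝ} (hx : a < x) (hxy : x ≤ y) : f x ≤ f y := by
  -- Cross-multiplied form of f(x)/f(y) ≤ f(x + n)/f(y + n). The right side tends to L/L = 1.
  have key : ∀ n : ℕ, f x * f (y + n) ≤ f y * f (x + n) := by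
    intro n
    induction n with
    | zero => simp [mul_comm]
    | succ n ih =>
      have hn : (0 : ℝ) ≤ n := n.cast_nonneg
      have hs := hstep (x + n) (y + n) (by linarith) (by linarith)
      have hxn : 0 < f (x + n) := hpos _ (by linarith)
      have hyn : 0 < f (y + n) := hpos _ (by linarith)
      have h1 : 0 < f (x + n + 1) := hpos _ (by linarith)
      have hy0 : 0 < f y := hpos _ (by linarith)
      push_cast
      rw [← add_assoc, ← add_assoc]
      have h2 : 0 < f x := hpos _ hx
      refine le_of_mul_le_mul_right ?_ (mul_pos hxn hyn)
      calc f x * f (y + n + 1) * (f (x + n) * f (y + n))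
          = (f x * f (y + n)) * (f (x + n) * f (y + n + 1)) := by ring
        _ ≤ (f y * f (x + n)) * (f (y + n) * f (x + n + 1)) :=
            mul_le_mul ih hs (mul_pos hxn (hpos _ (by linarith))).le (mul_pos hy0 hxn).le
        _ = f y * f (x + n + 1) * (f (x + n) * f (y + n)) := by ring
  have h := le_of_tendsto_of_tendsto' ((hlim y (hx.trans_le hxy)).const_mul (f x))
    ((hlim x hx).const_mul (f y)) key
  exact le_of_mul_le_mul_right h hL

/-- Midpoint log-convexity of the Gamma function. -/
theorem Gamma_add_half_sq_le {x : ℝ} (hx : 0 < x) :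
    Real.Gamma (x + 1 / 2) ^ 2 ≤ Real.Gamma x * Real.Gamma (x + 1) := by
  have h := Real.Gamma_mul_add_mul_le_rpow_Gamma_mul_rpow_Gamma (s := x) (t := x + 1)
    (a := 1 / 2) (b := 1 / 2) hx (by linarith) (by norm_num) (by norm_num) (by norm_num)
  have h1 : 0 < Real.Gamma x := Real.Gamma_pos_of_pos hx
  have h2 : 0 < Real.Gamma (x + 1) := Real.Gamma_pos_of_pos (by linarith)
  have h3 : 0 < Real.Gamma (x + 1 / 2) := Real.Gamma_pos_of_pos (by linarith)
  rw [← Real.sqrt_eq_rpow, ← Real.sqrt_eq_rpow, ← Real.sqrt_mul h1.le,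
    show 1 / 2 * x + 1 / 2 * (x + 1) = x + 1 / 2 by ring] at h
  exact (Real.le_sqrt h3.le (mul_pos h1 h2).le).1 h

/-- The squared ratio `Γ(x - 1/2)² / Γ(x)²`. -/
def gammaRatioSq (x : ℝ) : ℝ := Real.Gamma (x - 1 / 2) ^ 2 / Real.Gamma x ^ 2

theorem gammaRatioSq_pos {x : ℝ} (hx : 1 / 2 < x) : 0 < gammaRatioSq x := by
  have h1 : 0 < Real.Gamma x := Real.Gamma_pos_of_pos (by linarith)
  have h3 : 0 < Real.Gamma (x - 1 / 2) := Real.Gamma_pos_of_pos (by linarith)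
  unfold gammaRatioSq
  positivity

/-- Midpoint log-convexity on [x - 1/2, x + 1/2], with Γ(x + 1/2) = (x - 1/2) Γ(x - 1/2). -/
theorem le_gammaRatioSq {x : ℝ} (hx : 1 / 2 < x) : 1 / (x - 1 / 2) ≤ gammaRatioSq x := by
  have h1 : 0 < Real.Gamma x := Real.Gamma_pos_of_pos (by linarith)
  have h0 : 0 < x - 1 / 2 := by linarith
  have h := Gamma_add_half_sq_le h0
  rw [Real.Gamma_add_one h0.ne', show x - 1 / 2 + 1 / 2 = x by ring] at h
  unfold gammaRatioSq
  rw [div_le_div_iff₀ h0 (by positivity)]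
  nlinarith

/-- Midpoint log-convexity on [x - 1, x], with Γ(x) = (x - 1) Γ(x - 1). -/
theorem gammaRatioSq_le {x : ℝ} (hx : 1 < x) : gammaRatioSq x ≤ 1 / (x - 1) := by
  have h1 : 0 < Real.Gamma x := Real.Gamma_pos_of_pos (by linarith)
  have h0 : 0 < x - 1 := by linarith
  have h := Gamma_add_half_sq_le h0
  have h2 := Real.Gamma_add_one h0.ne'
  rw [show x - 1 + 1 = x by ring] at h h2
  rw [show x - 1 + 1 / 2 = x - 1 / 2 by ring] at h
  unfold gammaRatioSq
  rw [div_le_div_iff₀ (by positivity) h0]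
  calc _ ≤ Real.Gamma (x - 1) * Real.Gamma x * (x - 1) := by gcongr
    _ = 1 * Real.Gamma x ^ 2 := by rw [sq]; nth_rewrite 3 [h2]; ring

theorem gammaRatioSq_add_one {x : ℝ} (hx : 1 / 2 < x) :
    gammaRatioSq (x + 1) = gammaRatioSq x * ((x - 1 / 2) / x) ^ 2 := by
  have h0 : x - 1 / 2 ≠ 0 := by linarith
  have h1 : x ≠ 0 := by linarith
  unfold gammaRatioSq
  rw [Real.Gamma_add_one h1, show x + 1 - 1 / 2 = x - 1 / 2 + 1 by ring, Real.Gamma_add_one h0,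
    mul_pow, mul_pow, div_pow, mul_comm, mul_comm (x ^ 2), mul_div_mul_comm]

theorem tendsto_sub_mul_gammaRatioSq {c : ℝ} (x : ℝ) :
    Tendsto (fun n : ℕ => (x + n - c) * gammaRatioSq (x + n)) atTop (𝓝 1) := by
  have hx : Tendsto (fun n : ℕ => x + n) atTop atTop :=
    tendsto_atTop_add_const_left _ _ tendsto_natCast_atTop_atTop
  suffices Tendsto (fun y : ℝ => (y - c) * gammaRatioSq y) atTop (𝓝 1) from this.comp hx
  have hlim : ∀ d : ℝ, Tendsto (fun y : ℝ => (y - c) * (1 / (y - d))) atTop (𝓝 1) := by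
    intro d
    have h1 : Tendsto (fun y : ℝ => 1 + (d - c) * (y - d)⁻¹) atTop (𝓝 (1 + (d - c) * 0)) :=
      ((tendsto_inv_atTop_zero.comp
        (tendsto_atTop_add_const_right _ (-d) tendsto_id)).const_mul _).const_add _
    rw [mul_zero, add_zero] at h1
    refine h1.congr' ?_
    filter_upwards [eventually_gt_atTop d] with y hy
    have : y - d ≠ 0 := by linarith
    field_simp
    ring
  refine tendsto_of_tendsto_of_tendsto_of_le_of_le' (hlim (1 / 2)) (hlim 1) ?_ ?_
  · filter_upwards [eventually_gt_atTop (1 / 2), eventually_gt_atTop c] with y hy hc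
    exact mul_le_mul_of_nonneg_left (le_gammaRatioSq hy) (by linarith)
  · filter_upwards [eventually_gt_atTop 1, eventually_gt_atTop c] with y hy hc
    exact mul_le_mul_of_nonneg_left (gammaRatioSq_le hy) (by linarith)

/-- The recursion makes the Gamma factors on both sides of the ratio condition identical, so only a
rational inequality has to be checked for each c. -/
theorem sub_mul_gammaRatioSq_le {c : ℝ} (hc : 1 / 2 ≤ c)
    (hstep : ∀ x y : ℝ, c < x → x ≤ y →
      (x - c) * ((y + 1 - c) * ((y - 1 / 2) / y) ^ 2) ≤
        (y - c) * ((x + 1 - c) * ((x - 1 / 2) / x) ^ 2))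
    {x y : ℝ} (hx : c < x) (hxy : x ≤ y) :
    (x - c) * gammaRatioSq x ≤ (y - c) * gammaRatioSq y := by
  refine le_of_ratio_antitone (f := fun x => (x - c) * gammaRatioSq x) (a := c) (L := 1)
    (fun x hx => mul_pos (by linarith) (gammaRatioSq_pos (by linarith))) ?_ one_pos
    (fun x _ => tendsto_sub_mul_gammaRatioSq x) hx hxy
  intro x y hx hxy
  rw [gammaRatioSq_add_one (by linarith), gammaRatioSq_add_one (by linarith)]
  have h := mul_le_mul_of_nonneg_left (hstep x y hx hxy)
    (mul_pos (gammaRatioSq_pos (x := x) (by linarith))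
      (gammaRatioSq_pos (x := y) (by linarith))).le
  linarith

/-- The ratio of consecutive values is (x - 1/2)² / (x (x - 1)) = 1 + 1/(4x(x - 1)), which
decreases. -/
theorem sub_one_mul_gammaRatioSq_le {x y : ℝ} (hx : 1 < x) (hxy : x ≤ y) :
    (x - 1) * gammaRatioSq x ≤ (y - 1) * gammaRatioSq y := by
  refine sub_mul_gammaRatioSq_le (by norm_num) ?_ hx hxy
  intro x y hx hxy
  have h1 : (x + 1 - 1) * ((x - 1 / 2) / x) ^ 2 = (x - 1 / 2) ^ 2 / x := by
    field_simp; ring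
  have h2 : (y + 1 - 1) * ((y - 1 / 2) / y) ^ 2 = (y - 1 / 2) ^ 2 / y := by
    have : y ≠ 0 := by linarith
    field_simp; ring
  rw [h1, h2, mul_div_assoc', mul_div_assoc', div_le_div_iff₀ (by linarith) (by linarith)]
  nlinarith [mul_nonneg (sub_nonneg.2 hxy) (by linarith : 0 ≤ x + y - 1)]

theorem sub_three_halves_mul_gammaRatioSq_le {x y : ℝ} (hx : 3 / 2 < x) (hxy : x ≤ y) :
    (x - 3 / 2) * gammaRatioSq x ≤ (y - 3 / 2) * gammaRatioSq y := by
  refine sub_mul_gammaRatioSq_le (by norm_num) ?_ hx hxy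
  intro x y hx hxy
  have h (z : ℝ) : (z + 1 - 3 / 2) * ((z - 1 / 2) / z) ^ 2 = (z - 1 / 2) ^ 3 / z ^ 2 := by
    rw [div_pow]; ring
  rw [h, h, mul_div_assoc', mul_div_assoc',
    div_le_div_iff₀ (by nlinarith) (by nlinarith)]
  -- With s = x - 1/2 the denominator x²(x - 3/2) becomes s³ - 3s/4 - 1/4. The reciprocal ratio is 1
  -- - 3/(4s²) - 1/(4s³), which increases.
  obtain ⟨s, rfl⟩ : ∃ s, x = s + 1 / 2 := ⟨x - 1 / 2, by ring⟩
  obtain ⟨t, rfl⟩ : ∃ t, y = t + 1 / 2 := ⟨y - 1 / 2, by ring⟩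
  have hs : 1 < s := by linarith
  have hst : s ≤ t := by linarith
  have h3 : s ^ 3 ≤ t ^ 3 := by gcongr
  have h4 : 0 ≤ (s * t) * ((t - s) * (t + s)) :=
    mul_nonneg (by nlinarith) (mul_nonneg (by linarith) (by linarith))
  linarith

theorem gammaRatioSq_two : gammaRatioSq 2 = Real.pi / 4 := by
  have h : Real.Gamma (2 - 1 / 2) = √Real.pi / 2 := by
    rw [show (2 : ℝ) - 1 / 2 = 1 / 2 + 1 by norm_num, Real.Gamma_add_one (by norm_num),
      Real.Gamma_one_half_eq]
    ring
  rw [gammaRatioSq, h, div_pow, Real.sq_sqrt Real.pi_pos.le, Real.Gamma_two]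
  norm_num

theorem gammaRatioSq_four : gammaRatioSq 4 = 25 / 256 * Real.pi := by
  rw [show (4 : ℝ) = 2 + 1 + 1 by norm_num, gammaRatioSq_add_one (by norm_num),
    gammaRatioSq_add_one (by norm_num), gammaRatioSq_two]
  ring

theorem gammaRatioSq_nine_halves : gammaRatioSq (9 / 2) = 1024 / (1225 * Real.pi) := by
  have h : gammaRatioSq (3 / 2) = 4 / Real.pi := by
    have h : Real.Gamma (3 / 2) = √Real.pi / 2 := by
      rw [show (3 : ℝ) / 2 = 1 / 2 + 1 by norm_num, Real.Gamma_add_one (by norm_num),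
        Real.Gamma_one_half_eq]
      ring
    rw [gammaRatioSq, h, div_pow, Real.sq_sqrt Real.pi_pos.le,
      show (3 : ℝ) / 2 - 1 / 2 = 1 by norm_num, Real.Gamma_one]
    have := Real.pi_pos
    field_simp; norm_num
  rw [show (9 : ℝ) / 2 = 3 / 2 + 1 + 1 + 1 by norm_num, gammaRatioSq_add_one (by norm_num),
    gammaRatioSq_add_one (by norm_num), gammaRatioSq_add_one (by norm_num), h]
  have := Real.pi_pos
  field_simp
  norm_num

/-- Equality holds at x = 2, so ν = 4 is the equality case of the moment condition. -/
theorem pi_div_four_le_sub_one_mul_gammaRatioSq {x : ℝ} (hx : 2 ≤ x) :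
    Real.pi / 4 ≤ (x - 1) * gammaRatioSq x := by
  have h := sub_one_mul_gammaRatioSq_le (by norm_num) hx
  rw [gammaRatioSq_two] at h
  linarith

/-- The value at x = 4 is 125π/512, just below π/4 = 128π/512. -/
theorem sub_three_halves_mul_gammaRatioSq_lt {x : ℝ} (hx : 3 / 2 < x) (hx4 : x ≤ 4) :
    (x - 3 / 2) * gammaRatioSq x < Real.pi / 4 := by
  have h := sub_three_halves_mul_gammaRatioSq_le hx hx4
  rw [gammaRatioSq_four] at h
  linarith [Real.pi_pos]

/-- The value at x = 9/2 is 3072/(1225π), so the claim there is π² < 12288/1225 ≈ 10.03; the bound π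
< 3.15 suffices. -/
theorem pi_div_four_lt_sub_three_halves_mul_gammaRatioSq {x : ℝ} (hx : 9 / 2 ≤ x) :
    Real.pi / 4 < (x - 3 / 2) * gammaRatioSq x := by
  have h := sub_three_halves_mul_gammaRatioSq_le (by norm_num) hx
  rw [gammaRatioSq_nine_halves] at h
  refine lt_of_lt_of_le ?_ h
  have h0 := Real.pi_pos
  have h1 := Real.pi_lt_d2
  rw [mul_div_assoc', div_lt_div_iff₀ (by norm_num) (by positivity)]
  nlinarith

/-- A lower bound on `Γ(x - 1/2)² / Γ(x)²` that is valid from `x = 3/2` on. -/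
theorem pi_lt_mul_gammaRatioSq {x : ℝ} (hx : 3 / 2 < x) :
    Real.pi < (4 * x - 3) * gammaRatioSq x := by
  -- The bound at x itself gives only 3 < π at x = 3/2. Applying it at x + 1 and going back by the
  -- recursion gives 3.375 there.
  have h := le_gammaRatioSq (x := x + 1) (by linarith)
  rw [gammaRatioSq_add_one (by linarith)] at h
  have h1 : x ^ 2 / ((x - 1 / 2) ^ 2 * (x + 1 / 2)) ≤ gammaRatioSq x := by
    have h2 : 0 < (x - 1 / 2) ^ 2 := by nlinarith
    rw [div_pow, mul_div_assoc', div_le_div_iff₀ (by linarith) (by nlinarith)] at h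
    rw [div_le_iff₀ (by nlinarith)]
    linarith
  refine lt_of_lt_of_le ?_ (mul_le_mul_of_nonneg_left h1 (by linarith))
  have h2 : 0 < (x - 1 / 2) ^ 2 * (x + 1 / 2) := mul_pos (by nlinarith) (by linarith)
  rw [mul_div_assoc', lt_div_iff₀ h2]
  refine (mul_lt_mul_of_pos_right Real.pi_lt_d2 h2).trans ?_
  -- In s = x - 3/2 the difference of the two sides is a cubic with positive coefficients.
  obtain ⟨s, rfl⟩ : ∃ s, x = s + 3 / 2 := ⟨x - 3 / 2, by ring⟩
  have hs : 0 < s := by linarith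
  have : 0 < s ^ 3 := by positivity
  have : 0 < s ^ 2 := by positivity
  ring_nf
  linarith

end SkewT

/-! ### Moments of the mixing variable -/

namespace SkewT

open Set

theorem gammaPDFReal_mul_rpow_pow {ν x : ℝ} (hν : 0 < ν) (hx : 0 < x) (k : ℕ) :
    gammaPDFReal (ν / 2) (1 / 2) x * ((x / ν) ^ (-(1 / 2) : ℝ)) ^ k =
      (1 / 2) ^ (ν / 2) / Real.Gamma (ν / 2) * ν ^ ((k : ℝ) / 2) *
        (x ^ ((ν - k) / 2 - 1) * Real.exp (-(1 / 2 * x))) := by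
  have h1 : ((x / ν) ^ (-(1 / 2) : ℝ)) ^ k = x ^ (-((k : ℝ) / 2)) * ν ^ ((k : ℝ) / 2) := by
    rw [← Real.rpow_natCast, ← Real.rpow_mul (by positivity), Real.div_rpow hx.le hν.le,
      show -(1 / 2) * (k : ℝ) = -((k : ℝ) / 2) by ring, Real.rpow_neg hν.le, div_inv_eq_mul]
  have h2 : x ^ ((ν - k) / 2 - 1) = x ^ (ν / 2 - 1) * x ^ (-((k : ℝ) / 2)) := by
    rw [← Real.rpow_add hx]
    ring_nf
  rw [gammaPDFReal, if_pos hx.le, h1, h2]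
  ring

theorem integrableOn_rpow_mul_exp_neg_half {s : ℝ} (hs : 0 < s) :
    IntegrableOn (fun x : ℝ => x ^ (s - 1) * Real.exp (-(1 / 2 * x))) (Ioi 0) := by
  refine (integrableOn_rpow_mul_exp_neg_mul_rpow (s := s - 1) (p := 1) (b := 1 / 2)
    (by linarith) one_pos (by norm_num)).congr_fun (fun x _ => ?_) measurableSet_Ioi
  simp

theorem gammaPDFReal_mul_eq_zero {ν x : ℝ} (hν : 2 < ν) (hx : x ∉ Ioi (0 : ℝ)) (g : ℝ → ℝ) :
    gammaPDFReal (ν / 2) (1 / 2) x * g x = 0 := by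
  have hx' : x ≤ 0 := not_lt.1 hx
  rcases hx'.lt_or_eq with h | rfl
  · rw [gammaPDFReal, if_neg (not_le.2 h), zero_mul]
  -- `gammaPDFReal` uses its formula at 0 as well; it vanishes there because ν > 2 makes the
  -- exponent ν/2 - 1 nonzero.
  · rw [gammaPDFReal, if_pos le_rfl, Real.zero_rpow (by linarith)]
    simp

variable {Ω : Type*} [MeasurableSpace Ω] {P : Measure Ω} {ν : ℝ} {V : Ω → ℝ}

/-- Moments of `V ^ (-1/2)` when `ν V` has a chi-squared law with `ν` degrees of freedom. -/
theorem moment_rpow_neg_half (hν : 3 < ν)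
    (hV : HasLaw V ((chiSquaredMeasure ν).map fun x => x / ν) P) (k : ℕ) (hk : (k : ℝ) < ν) :
    Integrable (fun w => (V w ^ (-(1 / 2) : ℝ)) ^ k) P ∧
      ∫ w, (V w ^ (-(1 / 2) : ℝ)) ^ k ∂P =
        (ν / 2) ^ ((k : ℝ) / 2) * Real.Gamma ((ν - k) / 2) / Real.Gamma (ν / 2) := by
  have hν0 : 0 < ν := by linarith
  have hs : 0 < (ν - k) / 2 := by linarith
  have hf : Measurable fun x : ℝ => (x ^ (-(1 / 2) : ℝ)) ^ k := by fun_prop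
  have hdiv : Measurable fun x : ℝ => x / ν := by fun_prop
  have hg : Measurable fun x : ℝ => ((x / ν) ^ (-(1 / 2) : ℝ)) ^ k := hf.comp hdiv
  have hpdf : Measurable (gammaPDF (ν / 2) (1 / 2)) :=
    (measurable_gammaPDFReal _ _).ennreal_ofReal
  have htoReal : ∀ x, (gammaPDF (ν / 2) (1 / 2) x).toReal = gammaPDFReal (ν / 2) (1 / 2) x :=
    fun x => ENNReal.toReal_ofReal (gammaPDFReal_nonneg (by linarith) (by norm_num) x)
  have hfin : ∀ᵐ x ∂(volume : Measure ℝ), gammaPDF (ν / 2) (1 / 2) x < ∞ :=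
    Filter.Eventually.of_forall fun x => ENNReal.ofReal_lt_top
  have hzero : ∀ x, x ∉ Ioi (0 : ℝ) →
      gammaPDFReal (ν / 2) (1 / 2) x * ((x / ν) ^ (-(1 / 2) : ℝ)) ^ k = 0 := fun x hx =>
    gammaPDFReal_mul_eq_zero (by linarith) hx fun x => ((x / ν) ^ (-(1 / 2) : ℝ)) ^ k
  constructor
  · have h : Integrable (fun x : ℝ => (x ^ (-(1 / 2) : ℝ)) ^ k) (P.map V) := by
      rw [hV.map_eq, integrable_map_measure hf.aestronglyMeasurable hdiv.aemeasurable]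
      rw [chiSquaredMeasure, gammaMeasure,
        integrable_withDensity_iff_integrable_smul' hpdf hfin]
      simp only [htoReal, smul_eq_mul, Function.comp_apply]
      rw [← integrableOn_iff_integrable_of_support_subset (s := Ioi 0)
        (Function.support_subset_iff'.2 hzero)]
      exact IntegrableOn.congr_fun ((integrableOn_rpow_mul_exp_neg_half hs).const_mul _)
        (fun x hx => (gammaPDFReal_mul_rpow_pow hν0 hx k).symm) measurableSet_Ioi
    exact h.comp_aemeasurable hV.aemeasurable
  · have h1 := hV.integral_comp (f := fun x : ℝ => (x ^ (-(1 / 2) : ℝ)) ^ k)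
      hf.aestronglyMeasurable
    simp only [Function.comp_def] at h1
    rw [h1, integral_map hdiv.aemeasurable hf.aestronglyMeasurable, chiSquaredMeasure,
      gammaMeasure, integral_withDensity_eq_integral_toReal_smul hpdf hfin]
    simp only [htoReal, smul_eq_mul]
    rw [← setIntegral_eq_integral_of_forall_compl_eq_zero hzero,
      setIntegral_congr_fun measurableSet_Ioi
        (fun x hx => gammaPDFReal_mul_rpow_pow hν0 hx k), integral_const_mul,
      Real.integral_rpow_mul_exp_neg_mul_Ioi hs (by norm_num)]
    have h2 : (1 / 2 : ℝ) ^ (ν / 2) * (1 / (1 / 2)) ^ ((ν - k) / 2) = (1 / 2) ^ ((k : ℝ) / 2) := by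
      rw [one_div_one_div, one_div, Real.inv_rpow zero_le_two, Real.inv_rpow zero_le_two,
        ← Real.rpow_neg zero_le_two, ← Real.rpow_neg zero_le_two, ← Real.rpow_add two_pos]
      ring_nf
    rw [div_eq_mul_one_div ν 2, Real.mul_rpow hν0.le (by norm_num), ← div_eq_mul_one_div ν 2, ← h2]
    ring

theorem integral_rpow_neg_half_pos (hν : 3 < ν)
    (hV : HasLaw V ((chiSquaredMeasure ν).map fun x => x / ν) P) :
    0 < ∫ w, V w ^ (-(1 / 2) : ℝ) ∂P := by
  have h := (moment_rpow_neg_half hν hV 1 (by norm_num; linarith)).2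
  simp only [pow_one, Nat.cast_one] at h
  have h1 : 0 < Real.Gamma ((ν - 1) / 2) := Real.Gamma_pos_of_pos (by linarith)
  have h2 : 0 < Real.Gamma (ν / 2) := Real.Gamma_pos_of_pos (by linarith)
  rw [h]
  positivity

theorem sq_integral_rpow_neg_half (hν : 3 < ν)
    (hV : HasLaw V ((chiSquaredMeasure ν).map fun x => x / ν) P) :
    (∫ w, V w ^ (-(1 / 2) : ℝ) ∂P) ^ 2 = ν / 2 * gammaRatioSq (ν / 2) := by
  have h := (moment_rpow_neg_half hν hV 1 (by norm_num; linarith)).2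
  simp only [pow_one, Nat.cast_one] at h
  rw [h, ← Real.sqrt_eq_rpow, div_pow, mul_pow, Real.sq_sqrt (by linarith), gammaRatioSq,
    show (ν - 1) / 2 = ν / 2 - 1 / 2 by ring]
  ring

theorem integral_rpow_neg_half_sq (hν : 3 < ν)
    (hV : HasLaw V ((chiSquaredMeasure ν).map fun x => x / ν) P) :
    ∫ w, (V w ^ (-(1 / 2) : ℝ)) ^ 2 ∂P = ν / (ν - 2) := by
  have h := (moment_rpow_neg_half hν hV 2 (by norm_num; linarith)).2
  have h0 : (ν - 2) / 2 ≠ 0 := by linarith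
  have h1 : Real.Gamma ((ν - 2) / 2) ≠ 0 := (Real.Gamma_pos_of_pos (by linarith)).ne'
  have h2 := Real.Gamma_add_one h0
  rw [show (ν - 2) / 2 + 1 = ν / 2 by ring] at h2
  rw [h, h2]
  have : ν - 2 ≠ 0 := by linarith
  norm_num
  field_simp

/-- The Gamma arguments for k = 1 and k = 3 differ by one, which is why E(S) factors out of a. -/
theorem integral_rpow_neg_half_cube (hν : 3 < ν)
    (hV : HasLaw V ((chiSquaredMeasure ν).map fun x => x / ν) P) :
    ∫ w, (V w ^ (-(1 / 2) : ℝ)) ^ 3 ∂P = ν / (ν - 3) * ∫ w, V w ^ (-(1 / 2) : ℝ) ∂P := by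
  have h := (moment_rpow_neg_half hν hV 3 (by norm_num; linarith)).2
  have h' := (moment_rpow_neg_half hν hV 1 (by norm_num; linarith)).2
  simp only [pow_one, Nat.cast_one] at h'
  have h0 : (ν - 3) / 2 ≠ 0 := by linarith
  have h3 : Real.Gamma (ν / 2) ≠ 0 := (Real.Gamma_pos_of_pos (by linarith)).ne'
  have h2 := Real.Gamma_add_one h0
  rw [show (ν - 3) / 2 + 1 = (ν - 1) / 2 by ring] at h2
  rw [h, h', h2, show ((3 : ℕ) : ℝ) / 2 = 1 / 2 + 1 by norm_num, Real.rpow_add (by linarith),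
    Real.rpow_one]
  have : ν - 3 ≠ 0 := by linarith
  push_cast
  field_simp

end SkewT

/-! ### Gaussian moments on a half-line -/

namespace SkewT

open Set

/-- The truncated power `x ↦ x ^ k 1_{x ≥ 0}`. -/
def posPow (k : ℕ) : ℝ → ℝ := (Ici (0 : ℝ)).indicator fun x => x ^ k

theorem measurable_posPow (k : ℕ) : Measurable (posPow k) :=
  (measurable_id.pow_const k).indicator measurableSet_Ici

theorem integral_posPow (k : ℕ) :
    ∫ x, posPow k x ∂gaussianReal 0 1 =
      (√(2 * Real.pi))⁻¹ * ((1 / 2) ^ (-((k : ℝ) + 1) / 2) * (1 / 2) *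
        Real.Gamma (((k : ℝ) + 1) / 2)) := by
  rw [integral_gaussianReal_eq_integral_smul one_ne_zero,
    ← integral_rpow_mul_exp_neg_mul_rpow (p := 2) (q := k) (b := 1 / 2) two_pos
      (by have : (0 : ℝ) ≤ k := k.cast_nonneg
          linarith) (by norm_num), ← integral_const_mul,
    ← setIntegral_congr_set Ioi_ae_eq_Ici.symm, ← integral_indicator measurableSet_Ici]
  congr 1
  ext x
  by_cases hx : x ∈ Ici (0 : ℝ)
  · simp only [posPow, indicator_of_mem hx, smul_eq_mul, gaussianPDFReal]
    norm_num
    rw [mul_right_comm, mul_assoc]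
    congr 3
    ring
  · simp [posPow, indicator_of_notMem hx]

theorem integral_posPow_zero : ∫ x, posPow 0 x ∂gaussianReal 0 1 = 1 / 2 := by
  rw [integral_posPow, CharP.cast_eq_zero, zero_add, Real.Gamma_one_half_eq, one_div,
    Real.inv_rpow zero_le_two, ← Real.rpow_neg zero_le_two,
    show -(-1 / 2 : ℝ) = 1 / 2 by norm_num, ← Real.sqrt_eq_rpow,
    Real.sqrt_mul zero_le_two]
  have h1 : √2 ≠ 0 := by positivity
  have h2 : √Real.pi ≠ 0 := (Real.sqrt_pos.2 Real.pi_pos).ne'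
  field_simp

theorem integral_posPow_one : ∫ x, posPow 1 x ∂gaussianReal 0 1 = (√(2 * Real.pi))⁻¹ := by
  rw [integral_posPow]
  norm_num

theorem integral_posPow_two : ∫ x, posPow 2 x ∂gaussianReal 0 1 = 1 / 2 := by
  rw [← integral_posPow_zero, integral_posPow, integral_posPow,
    show (((2 : ℕ) : ℝ) + 1) / 2 = 1 / 2 + 1 by norm_num,
    show -(((2 : ℕ) : ℝ) + 1) / 2 = -(((0 : ℕ) : ℝ) + 1) / 2 + (-1) by norm_num,
    Real.Gamma_add_one (by norm_num), Real.rpow_add (by norm_num), Real.rpow_neg_one]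
  simp only [CharP.cast_eq_zero, zero_add]
  ring

theorem integral_posPow_three :
    ∫ x, posPow 3 x ∂gaussianReal 0 1 = 2 * (√(2 * Real.pi))⁻¹ := by
  rw [integral_posPow]
  norm_num
  ring

theorem integrable_posPow (k : ℕ) : Integrable (posPow k) (gaussianReal 0 1) := by
  refine Integrable.indicator ?_ measurableSet_Ici
  have h := memLp_id_gaussianReal (μ := 0) (v := 1) k
  exact h.integrable_norm_pow' |>.mono' (by fun_prop) (by simp)

theorem integral_cube_gaussianReal (v : NNReal) : ∫ x, x ^ 3 ∂gaussianReal 0 v = 0 := by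
  have h : ∫ x, x ^ 3 ∂gaussianReal 0 v = ∫ x, (-x) ^ 3 ∂gaussianReal 0 v := by
    rw [← integral_map (φ := fun x : ℝ => -x) (f := fun x => x ^ 3) (by fun_prop) (by fun_prop),
      gaussianReal_map_neg, neg_zero]
  have h2 : ∫ x, (-x) ^ 3 ∂gaussianReal 0 v = - ∫ x, x ^ 3 ∂gaussianReal 0 v := by
    rw [← integral_neg]
    congr 1
    ext x
    ring
  linarith

section Gaussian

variable {Ω : Type*} [MeasurableSpace Ω] {P : Measure Ω} {N U : Ω → ℝ}

theorem integrable_pow_of_hasGaussianLaw (hU : HasGaussianLaw U P) (k : ℕ) :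
    Integrable (fun w => U w ^ k) P := by
  have := hU.isProbabilityMeasure
  have h := hU.memLp (p := k) (by simp)
  exact h.integrable_norm_pow' |>.mono' (hU.aemeasurable.pow_const k).aestronglyMeasurable
    (by simp)

theorem integral_sq_of_hasGaussianLaw (hU : HasGaussianLaw U P) (hU0 : ∫ w, U w ∂P = 0) :
    ∫ w, U w ^ 2 ∂P = Var[U; P] := by
  rw [variance_of_integral_eq_zero hU.aemeasurable hU0]

theorem integral_cube_of_hasGaussianLaw (hU : HasGaussianLaw U P) (hU0 : ∫ w, U w ∂P = 0) :
    ∫ w, U w ^ 3 ∂P = 0 := by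
  have h := hU.map_eq_gaussianReal
  rw [hU0] at h
  rw [← integral_map (f := fun x : ℝ => x ^ 3) hU.aemeasurable (by fun_prop), h,
    integral_cube_gaussianReal]

/-- Moments of `U` restricted to `{N ≥ 0}`, for centred jointly Gaussian `N` and `U` with
`Var N = 1`. -/
theorem integral_posPow_mul_pow (hNU : HasGaussianLaw (fun w => (N w, U w)) P)
    (hN0 : ∫ w, N w ∂P = 0) (hU0 : ∫ w, U w ∂P = 0) (hN1 : Var[N; P] = 1) :
    ∫ w, posPow 0 (N w) ∂P = 1 / 2 ∧
    ∫ w, posPow 0 (N w) * U w ∂P = (√(2 * Real.pi))⁻¹ * cov[N, U; P] ∧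
    ∫ w, posPow 0 (N w) * U w ^ 2 ∂P = 1 / 2 * Var[U; P] ∧
    ∫ w, posPow 0 (N w) * U w ^ 3 ∂P =
      (√(2 * Real.pi))⁻¹ * (3 * cov[N, U; P] * Var[U; P] - cov[N, U; P] ^ 3) := by
  have := hNU.isProbabilityMeasure
  set c := cov[N, U; P] with hc
  have hN := hNU.fst
  have hU := hNU.snd
  -- The regression residual of U on N: uncorrelated with N, hence independent of it by joint
  -- Gaussianity. Each moment then comes from the binomial expansion of (E + cN)^k.
  set E : Ω → ℝ := fun w => U w - c * N w with hE
  have hNE : HasGaussianLaw (fun w => (N w, E w)) P := by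
    have h := hNU.map_fun ((ContinuousLinearMap.fst ℝ ℝ ℝ).prod
      (ContinuousLinearMap.snd ℝ ℝ ℝ - c • ContinuousLinearMap.fst ℝ ℝ ℝ))
    simpa using h
  have hEg := hNE.snd
  have hind : IndepFun N E P := by
    refine hNE.indepFun_of_covariance_eq_zero ?_
    rw [hE, covariance_fun_sub_right hN.memLp_two hU.memLp_two (hN.memLp_two.const_mul c),
      covariance_const_mul_right, covariance_self hN.aemeasurable, hN1, ← hc]
    ring
  have hE0 : ∫ w, E w ∂P = 0 := by
    rw [hE, integral_sub hU.integrable (hN.integrable.const_mul c), integral_const_mul, hN0, hU0]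
    simp
  have hE2 : ∫ w, E w ^ 2 ∂P = Var[U; P] - c ^ 2 := by
    rw [integral_sq_of_hasGaussianLaw hEg hE0, hE,
      variance_fun_sub hU.memLp_two (hN.memLp_two.const_mul c), variance_const_mul,
      covariance_const_mul_right, covariance_comm, ← hc, hN1]
    ring
  have hE3 := integral_cube_of_hasGaussianLaw hEg hE0
  have hlaw : HasLaw N (gaussianReal 0 1) P := by
    refine ⟨hN.aemeasurable, ?_⟩
    rw [hN.map_eq_gaussianReal, hN0, hN1, Real.toNNReal_one]
  have hpos (k : ℕ) : Integrable (fun w => posPow k (N w)) P := by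
    have h := integrable_posPow k
    rw [← hlaw.map_eq] at h
    exact h.comp_aemeasurable hN.aemeasurable
  have hposI (k : ℕ) : ∫ w, posPow k (N w) ∂P = ∫ x, posPow k x ∂gaussianReal 0 1 :=
    hlaw.integral_comp (measurable_posPow k).aestronglyMeasurable
  have hind' (k l : ℕ) : IndepFun (fun w => posPow k (N w)) (fun w => E w ^ l) P :=
    hind.comp (measurable_posPow k) (measurable_id.pow_const l)
  have hint (k l : ℕ) : Integrable (fun w => posPow k (N w) * E w ^ l) P :=
    (hind' k l).integrable_mul (hpos k) (integrable_pow_of_hasGaussianLaw hEg l)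
  have hval (k l : ℕ) : ∫ w, posPow k (N w) * E w ^ l ∂P =
      (∫ x, posPow k x ∂gaussianReal 0 1) * ∫ w, E w ^ l ∂P := by
    rw [← hposI]
    exact (hind' k l).integral_fun_mul_eq_mul_integral (hpos k).aestronglyMeasurable
      (integrable_pow_of_hasGaussianLaw hEg l).aestronglyMeasurable
  have hmul (k : ℕ) (x : ℝ) : posPow k x = posPow 0 x * x ^ k := by
    by_cases hx : x ∈ Ici (0 : ℝ) <;> simp [posPow, hx]
  refine ⟨by rw [hposI, integral_posPow_zero], ?_, ?_, ?_⟩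
  · have h : ∀ w, posPow 0 (N w) * U w = posPow 0 (N w) * E w ^ 1 +
        c * (posPow 1 (N w) * E w ^ 0) := by
      intro w
      rw [hmul 1]
      simp only [hE]
      ring
    simp_rw [h]
    rw [integral_add (hint 0 1) ((hint 1 0).const_mul _), integral_const_mul, hval, hval,
      integral_posPow_one]
    simp [hE0]
    ring
  · have h : ∀ w, posPow 0 (N w) * U w ^ 2 = posPow 0 (N w) * E w ^ 2 +
        (2 * c) * (posPow 1 (N w) * E w ^ 1) + c ^ 2 * (posPow 2 (N w) * E w ^ 0) := by
      intro w
      rw [hmul 1, hmul 2]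
      simp only [hE]
      ring
    simp_rw [h]
    have hi : Integrable (fun w => posPow 0 (N w) * E w ^ 2 +
        (2 * c) * (posPow 1 (N w) * E w ^ 1)) P := (hint 0 2).add ((hint 1 1).const_mul _)
    rw [integral_add hi ((hint 2 0).const_mul _),
      integral_add (hint 0 2) ((hint 1 1).const_mul _), integral_const_mul, integral_const_mul,
      hval, hval, hval, hE2, integral_posPow_zero, integral_posPow_two]
    simp [hE0]
    ring
  · have h : ∀ w, posPow 0 (N w) * U w ^ 3 = posPow 0 (N w) * E w ^ 3 +
        (3 * c) * (posPow 1 (N w) * E w ^ 2) + (3 * c ^ 2) * (posPow 2 (N w) * E w ^ 1) +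
        c ^ 3 * (posPow 3 (N w) * E w ^ 0) := by
      intro w
      rw [hmul 1, hmul 2, hmul 3]
      simp only [hE]
      ring
    simp_rw [h]
    have hi : Integrable (fun w => posPow 0 (N w) * E w ^ 3 +
        (3 * c) * (posPow 1 (N w) * E w ^ 2)) P := (hint 0 3).add ((hint 1 2).const_mul _)
    have hi' : Integrable (fun w => posPow 0 (N w) * E w ^ 3 +
        (3 * c) * (posPow 1 (N w) * E w ^ 2) + (3 * c ^ 2) * (posPow 2 (N w) * E w ^ 1)) P :=
      hi.add ((hint 2 1).const_mul _)
    rw [integral_add hi' ((hint 3 0).const_mul _), integral_add hi ((hint 2 1).const_mul _),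
      integral_add (hint 0 3) ((hint 1 2).const_mul _), integral_const_mul, integral_const_mul,
      integral_const_mul, hval, hval, hval, hval, hE2, hE3, integral_posPow_one,
      integral_posPow_three]
    simp [hE0]
    ring

end Gaussian

end SkewT

/-! ### The skew-normal law as a conditioned Gaussian -/

namespace SkewT

open Set

variable {p : ℕ}

/-- The standard Gaussian product measure on `ℝᵖ`. -/
def stdGaussianPi (p : ℕ) : Measure (Fin p → ℝ) := Measure.pi fun _ => gaussianReal 0 1

instance : IsProbabilityMeasure (stdGaussianPi p) := by
  unfold stdGaussianPi
  infer_instance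

theorem stdGaussianPi_eq_withDensity :
    stdGaussianPi p =
      volume.withDensity fun y => ENNReal.ofReal (∏ i, gaussianPDFReal 0 1 (y i)) := by
  refine (Measure.pi_eq fun s hs => ?_)
  rw [withDensity_apply _ (MeasurableSet.univ_pi hs),
    ← ofReal_integral_eq_lintegral_ofReal, volume_pi, Measure.restrict_pi_pi,
    integral_fintype_prod_eq_prod, ENNReal.ofReal_prod_of_nonneg]
  · exact Finset.prod_congr rfl fun i _ => (gaussianReal_apply_eq_integral 0 one_ne_zero _).symm
  · exact fun i _ => integral_nonneg fun x => gaussianPDFReal_nonneg _ _ _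
  · rw [volume_pi, Measure.restrict_pi_pi]
    exact Integrable.fintype_prod fun i => (integrable_gaussianPDFReal 0 1).restrict
  · exact Filter.Eventually.of_forall fun y =>
      Finset.prod_nonneg fun i _ => gaussianPDFReal_nonneg _ _ _

/-- The change of variables z = By: (By)'(BBᵀ)⁻¹(By) = y'y, and |det B| cancels the square root of
det(BBᵀ). -/
theorem abs_det_mul_normalDensity {B : Matrix (Fin p) (Fin p) ℝ} (hB : B.det ≠ 0)
    (y : Fin p → ℝ) :
    |B.det| * normalDensity (B * Bᵀ) (B *ᵥ y) = ∏ i, gaussianPDFReal 0 1 (y i) := by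
  have hu : IsUnit B.det := hB.isUnit
  have h1 : (B *ᵥ y) ⬝ᵥ ((B * Bᵀ)⁻¹ *ᵥ (B *ᵥ y)) = y ⬝ᵥ y := by
    rw [Matrix.mul_inv_rev, mulVec_mulVec, Matrix.mul_assoc, Matrix.nonsing_inv_mul _ hu,
      Matrix.mul_one, ← Matrix.transpose_nonsing_inv, mulVec_transpose, dotProduct_comm,
      ← dotProduct_mulVec, mulVec_mulVec, Matrix.nonsing_inv_mul _ hu, one_mulVec]
  have h2 : √((2 * Real.pi) ^ p * (B * Bᵀ).det) = √(2 * Real.pi) ^ p * |B.det| := by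
    rw [det_mul, det_transpose, Real.sqrt_mul (by positivity), Real.sqrt_mul_self_eq_abs]
    congr 1
    rw [Real.sqrt_eq_iff_mul_self_eq (by positivity) (by positivity), ← mul_pow,
      Real.mul_self_sqrt (by positivity)]
  have h3 : |B.det| ≠ 0 := abs_ne_zero.2 hB
  simp only [gaussianPDFReal, Finset.prod_mul_distrib, Finset.prod_const, Finset.card_univ,
    Fintype.card_fin, ← Real.exp_sum]
  rw [normalDensity, h1, h2, mul_inv, ← mul_assoc, mul_comm _ (|B.det|)⁻¹, ← mul_assoc,
    mul_inv_cancel₀ h3, one_mul, inv_pow]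
  congr 2
  · simp
  · simp [dotProduct, sq, Finset.sum_div, neg_div]

theorem map_mulVec_stdGaussianPi {B : Matrix (Fin p) (Fin p) ℝ} (hB : B.det ≠ 0) :
    (stdGaussianPi p).map (fun y => B *ᵥ y) =
      volume.withDensity fun z => ENNReal.ofReal (normalDensity (B * Bᵀ) z) := by
  have hm : Measurable fun y : Fin p → ℝ => B *ᵥ y :=
    (continuous_const.matrix_mulVec continuous_id).measurable
  have hd : Measurable fun z => ENNReal.ofReal (normalDensity (B * Bᵀ) z) := by
    refine ENNReal.measurable_ofReal.comp (Continuous.measurable ?_)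
    unfold normalDensity
    fun_prop
  have hvol : (volume : Measure (Fin p → ℝ)) =
      ENNReal.ofReal |B.det| • volume.map fun y => B *ᵥ y := by
    have h := Real.map_matrix_volume_pi_eq_smul_volume_pi hB
    have h' : (volume : Measure (Fin p → ℝ)).map (fun y => B *ᵥ y) =
      ENNReal.ofReal |(B.det)⁻¹| • volume := h
    rw [h', smul_smul, ← ENNReal.ofReal_mul (abs_nonneg _), ← abs_mul, mul_inv_cancel₀ hB]
    simp
  ext s hs
  rw [Measure.map_apply hm hs, withDensity_apply _ hs, hvol, Measure.restrict_smul,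
    lintegral_smul_measure, setLIntegral_map hs hd hm, stdGaussianPi_eq_withDensity,
    withDensity_apply _ (hm hs), smul_eq_mul,
    ← lintegral_const_mul' _ _ ENNReal.ofReal_ne_top]
  refine lintegral_congr fun y => ?_
  rw [← ENNReal.ofReal_mul (abs_nonneg _), abs_det_mul_normalDensity hB]

theorem measurable_mulVec_fst (B : Matrix (Fin p) (Fin p) ℝ) :
    Measurable fun q : (Fin p → ℝ) × ℝ => B *ᵥ q.1 :=
  (continuous_const.matrix_mulVec continuous_fst).measurable

theorem measurable_dotProduct_mulVec_fst_sub (B : Matrix (Fin p) (Fin p) ℝ) (α : Fin p → ℝ) :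
    Measurable fun q : (Fin p → ℝ) × ℝ => α ⬝ᵥ (B *ᵥ q.1) - q.2 :=
  ((continuous_const.dotProduct (continuous_const.matrix_mulVec continuous_fst)).sub
    continuous_snd).measurable

/-- The skew-normal law is that of a Gaussian vector `Y` conditioned on `T ≤ α' Y`, with `T` an
independent standard normal variable. -/
theorem skewNormalMeasure_eq {B : Matrix (Fin p) (Fin p) ℝ} (hB : B.det ≠ 0) (α : Fin p → ℝ) :
    skewNormalMeasure (B * Bᵀ) α =
      (2 : ℝ≥0∞) • (((stdGaussianPi p).prod (gaussianReal 0 1)).restrict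
        {q | 0 ≤ α ⬝ᵥ (B *ᵥ q.1) - q.2}).map fun q => B *ᵥ q.1 := by
  have hm : Measurable fun y : Fin p → ℝ => B *ᵥ y :=
    (continuous_const.matrix_mulVec continuous_id).measurable
  have hd : Measurable fun z => ENNReal.ofReal (normalDensity (B * Bᵀ) z) := by
    refine ENNReal.measurable_ofReal.comp (Continuous.measurable ?_)
    unfold normalDensity
    fun_prop
  have hdot : Measurable fun z : Fin p → ℝ => α ⬝ᵥ z :=
    (continuous_const.dotProduct continuous_id).measurable
  have hc : Measurable fun z : Fin p → ℝ =>
      (2 : ℝ≥0∞) * ENNReal.ofReal (cdf (gaussianReal 0 1) (α ⬝ᵥ z)) :=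
    (((monotone_cdf _).measurable.comp hdot).ennreal_ofReal).const_mul _
  have hS : MeasurableSet {q : (Fin p → ℝ) × ℝ | 0 ≤ α ⬝ᵥ (B *ᵥ q.1) - q.2} :=
    measurableSet_le measurable_const (measurable_dotProduct_mulVec_fst_sub B α)
  -- The density relative to the Gaussian law is 2Φ(α'z) = 2 P(T ≤ α'z); Fubini then identifies the
  -- two sides.
  have h1 : skewNormalMeasure (B * Bᵀ) α = ((stdGaussianPi p).map fun y => B *ᵥ y).withDensity
      fun z => (2 : ℝ≥0∞) * ENNReal.ofReal (cdf (gaussianReal 0 1) (α ⬝ᵥ z)) := by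
    rw [map_mulVec_stdGaussianPi hB, ← withDensity_mul _ hd hc, skewNormalMeasure]
    congr 1
    ext z
    have : 0 ≤ normalDensity (B * Bᵀ) z := by
      unfold normalDensity
      positivity
    rw [skewNormalDensity, ENNReal.ofReal_mul (by positivity), ENNReal.ofReal_mul zero_le_two,
      ENNReal.ofReal_ofNat, Pi.mul_apply]
    ring
  rw [h1]
  ext s hs
  rw [withDensity_apply _ hs, setLIntegral_map hs hc hm, Measure.smul_apply, smul_eq_mul,
    Measure.map_apply (measurable_mulVec_fst B) hs,
    Measure.restrict_apply (measurable_mulVec_fst B hs),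
    Measure.prod_apply ((measurable_mulVec_fst B hs).inter hS),
    ← lintegral_indicator (hm hs), ← lintegral_const_mul _
      (measurable_measure_prodMk_left ((measurable_mulVec_fst B hs).inter hS))]
  refine lintegral_congr fun y => ?_
  by_cases hy : B *ᵥ y ∈ s
  · rw [indicator_of_mem (by exact hy), ofReal_cdf]
    congr 2
    ext t
    simp [hy]
  · rw [indicator_of_notMem (by exact hy)]
    have : (Prod.mk y ⁻¹' ((fun q : (Fin p → ℝ) × ℝ => B *ᵥ q.1) ⁻¹' s ∩
        {q | 0 ≤ α ⬝ᵥ (B *ᵥ q.1) - q.2})) = ∅ := by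
      ext t
      simp [hy]
    rw [this]
    simp

theorem hasGaussianLaw_stdGaussianPi_prod :
    HasGaussianLaw id ((stdGaussianPi p).prod (gaussianReal 0 1)) := by
  have h1 : HasGaussianLaw (fun (y : Fin p → ℝ) (i : Fin p) => y i) (stdGaussianPi p) := by
    refine iIndepFun.hasGaussianLaw (X := fun i (y : Fin p → ℝ) => y i) (fun i => ?_)
      (iIndepFun_pi (μ := fun _ => gaussianReal 0 1) (X := fun _ => id) fun _ => aemeasurable_id)
    have h : HasLaw (fun y : Fin p → ℝ => y i) (gaussianReal 0 1) (stdGaussianPi p) :=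
      (measurePreserving_eval (fun _ : Fin p => gaussianReal 0 1) i).hasLaw
    exact h.hasGaussianLaw
  have h2 : IsGaussian (stdGaussianPi p) := by
    have := h1.isGaussian_map
    simpa using this
  exact IsGaussian.hasGaussianLaw_id

theorem hasGaussianLaw_of_linear {F : Type*} [NormedAddCommGroup F] [NormedSpace ℝ F]
    [MeasurableSpace F] [BorelSpace F] [SecondCountableTopology F]
    (L : ((Fin p → ℝ) × ℝ) →ₗ[ℝ] F) :
    HasGaussianLaw (fun q => L q) ((stdGaussianPi p).prod (gaussianReal 0 1)) := by
  have := hasGaussianLaw_stdGaussianPi_prod (p := p)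
  exact this.map_fun (LinearMap.toContinuousLinearMap L)

/-- The linear form `(y, t) ↦ a' y + c t`. -/
def affForm (a : Fin p → ℝ) (c : ℝ) : ((Fin p → ℝ) × ℝ) →ₗ[ℝ] ℝ where
  toFun q := a ⬝ᵥ q.1 + c * q.2
  map_add' x y := by simp [dotProduct_add]; ring
  map_smul' r x := by simp; ring

theorem affForm_apply (a : Fin p → ℝ) (c : ℝ) (q : (Fin p → ℝ) × ℝ) :
    affForm a c q = a ⬝ᵥ q.1 + c * q.2 := rfl

theorem cov_affForm (a b : Fin p → ℝ) (c d : ℝ) :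
    cov[fun q => affForm a c q, fun q => affForm b d q;
      (stdGaussianPi p).prod (gaussianReal 0 1)] = a ⬝ᵥ b + c * d := by
  set μ := (stdGaussianPi p).prod (gaussianReal 0 1)
  have hcoord (i : Fin p) : MemLp (fun y : Fin p → ℝ => y i) 2 (stdGaussianPi p) := by
    have h : HasLaw (fun y : Fin p → ℝ => y i) (gaussianReal 0 1) (stdGaussianPi p) :=
      (measurePreserving_eval (fun _ : Fin p => gaussianReal 0 1) i).hasLaw
    exact h.hasGaussianLaw.memLp_two
  have hdot (a : Fin p → ℝ) : MemLp (fun y : Fin p → ℝ => a ⬝ᵥ y) 2 (stdGaussianPi p) :=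
    memLp_finsetSum _ fun i _ => (hcoord i).const_mul (a i)
  have hid : MemLp (fun x : ℝ => x) 2 (gaussianReal 0 1) :=
    memLp_id_gaussianReal' 2 (by simp)
  have hfst : HasLaw (fun q : (Fin p → ℝ) × ℝ => q.1) (stdGaussianPi p) μ :=
    measurePreserving_fst.hasLaw
  have hsnd : HasLaw (fun q : (Fin p → ℝ) × ℝ => q.2) (gaussianReal 0 1) μ :=
    measurePreserving_snd.hasLaw
  have h1 (a : Fin p → ℝ) : MemLp (fun q : (Fin p → ℝ) × ℝ => a ⬝ᵥ q.1) 2 μ :=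
    (hdot a).comp_measurePreserving measurePreserving_fst
  have h2 (c : ℝ) : MemLp (fun q : (Fin p → ℝ) × ℝ => c * q.2) 2 μ :=
    (hid.comp_measurePreserving measurePreserving_snd).const_mul c
  have hcc (i j : Fin p) : cov[fun y : Fin p → ℝ => y i, fun y => y j; stdGaussianPi p] =
      if i = j then 1 else 0 := by
    split_ifs with h
    · subst h
      rw [covariance_self (hcoord i).aestronglyMeasurable.aemeasurable]
      have h : HasLaw (fun y : Fin p → ℝ => y i) (gaussianReal 0 1) (stdGaussianPi p) :=
        (measurePreserving_eval (fun _ : Fin p => gaussianReal 0 1) i).hasLaw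
      rw [h.variance_eq, variance_id_gaussianReal]
      simp
    · have hi := (iIndepFun_pi (μ := fun _ : Fin p => gaussianReal 0 1) (X := fun _ => id)
        fun _ => aemeasurable_id).indepFun h
      exact hi.covariance_eq_zero (hcoord i) (hcoord j)
  have h11 : cov[fun q : (Fin p → ℝ) × ℝ => a ⬝ᵥ q.1, fun q => b ⬝ᵥ q.1; μ] = a ⬝ᵥ b := by
    rw [hfst.covariance_fun_comp (f := fun y => a ⬝ᵥ y) (g := fun y => b ⬝ᵥ y)
      (hdot a).aestronglyMeasurable.aemeasurable (hdot b).aestronglyMeasurable.aemeasurable]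
    simp only [dotProduct]
    rw [covariance_fun_sum_fun_sum (fun i => (hcoord i).const_mul _)
      (fun i => (hcoord i).const_mul _)]
    simp [covariance_const_mul_left, covariance_const_mul_right, hcc, mul_comm]
  have h22 : cov[fun q : (Fin p → ℝ) × ℝ => c * q.2, fun q => d * q.2; μ] = c * d := by
    rw [covariance_const_mul_left, covariance_const_mul_right,
      hsnd.covariance_fun_comp (f := fun x => x) (g := fun x => x) (by fun_prop) (by fun_prop),
      covariance_self (by fun_prop), variance_fun_id_gaussianReal]
    simp
  have h12 (a : Fin p → ℝ) (d : ℝ) :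
      cov[fun q : (Fin p → ℝ) × ℝ => a ⬝ᵥ q.1, fun q => d * q.2; μ] = 0 :=
    covariance_fst_snd_prod (X := fun y => a ⬝ᵥ y) (Y := fun x => d * x) (hdot a)
      (hid.const_mul d)
  simp only [affForm_apply]
  have hadd (f g k l : (Fin p → ℝ) × ℝ → ℝ) (hf : MemLp f 2 μ) (hg : MemLp g 2 μ)
      (hk : MemLp k 2 μ) (hl : MemLp l 2 μ) :
      cov[fun q => f q + g q, fun q => k q + l q; μ] =
        cov[f, k; μ] + cov[f, l; μ] + (cov[g, k; μ] + cov[g, l; μ]) := by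
    have e1 : (fun q => f q + g q) = f + g := rfl
    have e2 : (fun q => k q + l q) = k + l := rfl
    rw [e1, e2, covariance_add_left hf hg (hk.add hl), covariance_add_right hf hk hl,
      covariance_add_right hg hk hl]
  rw [hadd _ _ _ _ (h1 a) (h2 c) (h1 b) (h2 d), h11, h22, h12,
    covariance_comm, h12]
  ring

theorem integral_affForm (a : Fin p → ℝ) (c : ℝ) :
    ∫ q, affForm a c q ∂(stdGaussianPi p).prod (gaussianReal 0 1) = 0 := by
  have hfst : MeasurePreserving Prod.fst ((stdGaussianPi p).prod (gaussianReal 0 1))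
    (stdGaussianPi p) := measurePreserving_fst
  have hcoord (i : Fin p) : HasLaw (fun q : (Fin p → ℝ) × ℝ => q.1 i) (gaussianReal 0 1)
      ((stdGaussianPi p).prod (gaussianReal 0 1)) :=
    ((measurePreserving_eval (fun _ : Fin p => gaussianReal 0 1) i).comp hfst).hasLaw
  have hsnd : HasLaw (fun q : (Fin p → ℝ) × ℝ => q.2) (gaussianReal 0 1)
      ((stdGaussianPi p).prod (gaussianReal 0 1)) := measurePreserving_snd.hasLaw
  have hi (i : Fin p) := ((hcoord i).hasGaussianLaw.integrable).const_mul (a i)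
  simp only [affForm_apply, dotProduct]
  rw [integral_add (integrable_finsetSum _ fun i _ => hi i)
    (hsnd.hasGaussianLaw.integrable.const_mul c), integral_finsetSum _ fun i _ => hi i]
  simp [integral_const_mul, (hcoord _).integral_eq, hsnd.integral_eq, integral_id_gaussianReal]

end SkewT

/-! ### Moments of skew-normal projections -/

namespace SkewT

open Set

variable {p : ℕ}

open scoped MatrixOrder in
theorem exists_eq_mul_transpose {R : Matrix (Fin p) (Fin p) ℝ} (hR : R.PosDef) :
    ∃ B : Matrix (Fin p) (Fin p) ℝ, B.det ≠ 0 ∧ R = B * Bᵀ := by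
  have hsq : CFC.sqrt R * CFC.sqrt R = R := CFC.sqrt_mul_sqrt_self R hR.posSemidef.nonneg
  have hsymm : (CFC.sqrt R)ᵀ = CFC.sqrt R := by
    rw [← Matrix.conjTranspose_eq_transpose_of_trivial]
    exact (CFC.sqrt_nonneg R).posSemidef.isHermitian
  refine ⟨CFC.sqrt R, fun h => hR.det_pos.ne' ?_, by rw [hsymm, hsq]⟩
  rw [← hsq, det_mul, h, zero_mul]

/-- The standardized skewness parameter `u' R α / √(1 + α' R α)` of the projection onto `u` of a
skew-normal vector. -/
def projDelta (R : Matrix (Fin p) (Fin p) ℝ) (α u : Fin p → ℝ) : ℝ :=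
  (u ⬝ᵥ (R *ᵥ α)) / √(1 + α ⬝ᵥ (R *ᵥ α))

/-- The first three moments of the projections of a skew-normal vector. -/
theorem skewNormalMeasure_moments {R : Matrix (Fin p) (Fin p) ℝ} (hR : R.PosDef)
    (α u : Fin p → ℝ) :
    IsProbabilityMeasure (skewNormalMeasure R α) ∧
    (∀ k : ℕ, Integrable (fun z => (u ⬝ᵥ z) ^ k) (skewNormalMeasure R α)) ∧
    ∫ z, u ⬝ᵥ z ∂skewNormalMeasure R α = 2 * (√(2 * Real.pi))⁻¹ * projDelta R α u ∧
    ∫ z, (u ⬝ᵥ z) ^ 2 ∂skewNormalMeasure R α = u ⬝ᵥ (R *ᵥ u) ∧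
    ∫ z, (u ⬝ᵥ z) ^ 3 ∂skewNormalMeasure R α = 2 * (√(2 * Real.pi))⁻¹ *
      (3 * projDelta R α u * (u ⬝ᵥ (R *ᵥ u)) - projDelta R α u ^ 3) := by
  obtain ⟨B, hB, rfl⟩ := exists_eq_mul_transpose hR
  have hform (x y : Fin p → ℝ) : x ⬝ᵥ ((B * Bᵀ) *ᵥ y) = (x ᵥ* B) ⬝ᵥ (y ᵥ* B) := by
    rw [← mulVec_mulVec, dotProduct_mulVec, mulVec_transpose]
  set μ := (stdGaussianPi p).prod (gaussianReal 0 1) with hμ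
  set a := u ᵥ* B with ha
  set b := α ᵥ* B with hb
  set s := √(1 + α ⬝ᵥ ((B * Bᵀ) *ᵥ α)) with hs
  have hbb : 0 ≤ b ⬝ᵥ b :=
    Finset.sum_nonneg fun i _ => mul_self_nonneg (b i)
  have hs2 : s ^ 2 = 1 + b ⬝ᵥ b := by
    rw [hs, hform, Real.sq_sqrt (by linarith)]
  have hs0 : 0 < s := by
    rw [hs, hform]
    exact Real.sqrt_pos.2 (by linarith)
  -- N is α'By - t scaled to unit variance. The conditioning event is N ≥ 0, and its covariance with
  -- U is `projDelta`.
  set N : (Fin p → ℝ) × ℝ → ℝ := fun q => affForm (s⁻¹ • b) (-s⁻¹) q with hN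
  set U : (Fin p → ℝ) × ℝ → ℝ := fun q => affForm a 0 q with hU
  have hNU : HasGaussianLaw (fun q => (N q, U q)) μ :=
    hasGaussianLaw_of_linear ((affForm (s⁻¹ • b) (-s⁻¹)).prod (affForm a 0))
  have hN1 : Var[N; μ] = 1 := by
    rw [← covariance_self hNU.fst.aemeasurable, hN, cov_affForm]
    simp only [smul_dotProduct, dotProduct_smul, smul_eq_mul]
    have : s⁻¹ * (s⁻¹ * b ⬝ᵥ b) + -s⁻¹ * -s⁻¹ = s⁻¹ ^ 2 * (1 + b ⬝ᵥ b) := by ring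
    rw [this, ← hs2, ← mul_pow, inv_mul_cancel₀ hs0.ne', one_pow]
  have hUv : Var[U; μ] = u ⬝ᵥ ((B * Bᵀ) *ᵥ u) := by
    rw [← covariance_self hNU.snd.aemeasurable, hU, cov_affForm, hform]
    ring
  have hcov : cov[N, U; μ] = projDelta (B * Bᵀ) α u := by
    rw [hN, hU, cov_affForm, projDelta, ← hs, hform, smul_dotProduct, dotProduct_comm b a]
    simp only [smul_eq_mul]
    ring
  obtain ⟨m0, m1, m2, m3⟩ :=
    integral_posPow_mul_pow hNU (integral_affForm _ _) (integral_affForm _ _) hN1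
  rw [hcov] at m1 m3
  rw [hUv] at m2 m3
  set S := {q : (Fin p → ℝ) × ℝ | 0 ≤ α ⬝ᵥ (B *ᵥ q.1) - q.2}
  have hS : MeasurableSet S :=
    measurableSet_le measurable_const (measurable_dotProduct_mulVec_fst_sub B α)
  have hNS (q : (Fin p → ℝ) × ℝ) : q ∈ S ↔ 0 ≤ N q := by
    have h : N q = s⁻¹ * (α ⬝ᵥ (B *ᵥ q.1) - q.2) := by
      rw [hN]
      simp only [affForm_apply, smul_dotProduct, smul_eq_mul, hb, dotProduct_mulVec]
      ring
    rw [h]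
    exact (mul_nonneg_iff_of_pos_left (inv_pos.2 hs0)).symm
  have hUq (q : (Fin p → ℝ) × ℝ) : u ⬝ᵥ (B *ᵥ q.1) = U q := by
    simp [hU, affForm_apply, ha, dotProduct_mulVec]
  have hmB := measurable_mulVec_fst B
  have hdot (k : ℕ) : Measurable fun z : Fin p → ℝ => (u ⬝ᵥ z) ^ k :=
    (continuous_const.dotProduct continuous_id).measurable.pow_const k
  have hint (k : ℕ) : ∫ z, (u ⬝ᵥ z) ^ k ∂skewNormalMeasure (B * Bᵀ) α =
      2 * ∫ q, posPow 0 (N q) * U q ^ k ∂μ := by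
    rw [skewNormalMeasure_eq hB, integral_smul_measure,
      integral_map hmB.aemeasurable (hdot k).aestronglyMeasurable, ← integral_indicator hS]
    simp only [ENNReal.toReal_ofNat, smul_eq_mul]
    congr 2
    ext q
    by_cases hq : q ∈ S
    · have := (hNS q).1 hq
      simp [posPow, indicator_of_mem hq, hUq, this]
    · have := mt (hNS q).2 hq
      simp [posPow, indicator_of_notMem hq, this]
  have hint0 : ∫ z, (1 : ℝ) ∂skewNormalMeasure (B * Bᵀ) α = 1 := by
    have h := hint 0
    simp only [pow_zero, mul_one] at h
    rw [h, m0]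
    norm_num
  refine ⟨?_, fun k => ?_, ?_, ?_, ?_⟩
  · rw [integral_const, smul_eq_mul, mul_one, Measure.real,
      ENNReal.toReal_eq_one_iff] at hint0
    exact ⟨hint0⟩
  · rw [skewNormalMeasure_eq hB]
    refine Integrable.smul_measure ?_ (by simp)
    rw [integrable_map_measure (hdot k).aestronglyMeasurable hmB.aemeasurable]
    have h := (integrable_pow_of_hasGaussianLaw hNU.snd k).restrict (s := S)
    exact h.congr (Filter.Eventually.of_forall fun q => by simp [hUq])
  · have h := hint 1
    simp only [pow_one] at h
    rw [h, m1]
    ring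
  · rw [hint 2, m2]
    ring
  · rw [hint 3, m3]
    ring

end SkewT

/-! ### Central moments of scale mixture projections -/

namespace SkewT

variable {p : ℕ}

section ScaleMixture

variable {H : Measure ℝ} [IsProbabilityMeasure H] {R : Matrix (Fin p) (Fin p) ℝ}

/-- Moments of the projections `s (u' z)` of a scale mixture. -/
theorem scaleMixture_moment (hR : R.PosDef) (α u : Fin p → ℝ) {k : ℕ}
    (hk : Integrable (fun s => s ^ k) H) :
    Integrable (fun q : ℝ × (Fin p → ℝ) => (q.1 * (u ⬝ᵥ q.2)) ^ k)
      (H.prod (skewNormalMeasure R α)) ∧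
    ∫ q, (q.1 * (u ⬝ᵥ q.2)) ^ k ∂H.prod (skewNormalMeasure R α) =
      (∫ s, s ^ k ∂H) * ∫ z, (u ⬝ᵥ z) ^ k ∂skewNormalMeasure R α := by
  obtain ⟨hprob, hint, -⟩ := skewNormalMeasure_moments hR α u
  simp only [mul_pow]
  exact ⟨hk.mul_prod (hint k),
    integral_prod_mul (fun s : ℝ => s ^ k) fun z : Fin p → ℝ => (u ⬝ᵥ z) ^ k⟩

theorem scaleMixture_memLp (hR : R.PosDef) (α u : Fin p → ℝ)
    (h3 : Integrable (fun s => s ^ 3) H) :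
    MemLp (fun q : ℝ × (Fin p → ℝ) => q.1 * (u ⬝ᵥ q.2)) 3 (H.prod (skewNormalMeasure R α)) := by
  have hm : Measurable fun q : ℝ × (Fin p → ℝ) => q.1 * (u ⬝ᵥ q.2) :=
    (continuous_fst.mul (continuous_const.dotProduct continuous_snd)).measurable
  rw [← integrable_norm_rpow_iff hm.aestronglyMeasurable (by norm_num) (by norm_num)]
  refine (scaleMixture_moment hR α u h3).1.norm.congr (Filter.Eventually.of_forall fun q => ?_)
  simp only [ENNReal.toReal_ofNat, norm_pow]
  exact_mod_cast (Real.rpow_natCast _ 3).symm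

end ScaleMixture

section Location

variable {Ω : Type*} [MeasurableSpace Ω] {μ : Measure Ω} [IsProbabilityMeasure μ] {W : Ω → ℝ}

theorem integral_sub_pow_two {e1 e2 : ℝ} (c : ℝ) (h1 : Integrable W μ)
    (h2 : Integrable (fun w => W w ^ 2) μ) (he1 : ∫ w, W w ∂μ = e1)
    (he2 : ∫ w, W w ^ 2 ∂μ = e2) :
    ∫ w, (W w - c) ^ 2 ∂μ = e2 - 2 * c * e1 + c ^ 2 := by
  have h : ∀ w, (W w - c) ^ 2 = W w ^ 2 - 2 * c * W w + c ^ 2 := fun w => by ring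
  have hi : Integrable (fun w => W w ^ 2 - 2 * c * W w) μ := h2.sub (h1.const_mul _)
  simp_rw [h]
  rw [integral_add hi (integrable_const _), integral_sub h2 (h1.const_mul _), integral_const_mul,
    he1, he2]
  simp

theorem integral_sub_pow_three {e1 e2 e3 : ℝ} (c : ℝ) (h1 : Integrable W μ)
    (h2 : Integrable (fun w => W w ^ 2) μ) (h3 : Integrable (fun w => W w ^ 3) μ)
    (he1 : ∫ w, W w ∂μ = e1) (he2 : ∫ w, W w ^ 2 ∂μ = e2) (he3 : ∫ w, W w ^ 3 ∂μ = e3) :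
    ∫ w, (W w - c) ^ 3 ∂μ = e3 - 3 * c * e2 + 3 * c ^ 2 * e1 - c ^ 3 := by
  have h : ∀ w, (W w - c) ^ 3 = W w ^ 3 - 3 * c * W w ^ 2 + 3 * c ^ 2 * W w - c ^ 3 :=
    fun w => by ring
  have hi : Integrable (fun w => W w ^ 3 - 3 * c * W w ^ 2) μ := h3.sub (h2.const_mul _)
  have hi' : Integrable (fun w => W w ^ 3 - 3 * c * W w ^ 2 + 3 * c ^ 2 * W w) μ :=
    hi.add (h1.const_mul _)
  simp_rw [h]
  rw [integral_sub hi' (integrable_const _), integral_add hi (h1.const_mul _),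
    integral_sub h3 (h2.const_mul _), integral_const_mul, integral_const_mul, he1, he2, he3]
  simp

end Location

theorem scaleDiag_isUnit {Om : Matrix (Fin p) (Fin p) ℝ} (hOm : Om.PosDef) :
    IsUnit (scaleDiag Om).det := by
  rw [scaleDiag, det_diagonal, isUnit_iff_ne_zero]
  exact Finset.prod_ne_zero_iff.2 fun i _ => (Real.sqrt_pos.2 hOm.diag_pos).ne'

theorem scaleDiag_transpose (Om : Matrix (Fin p) (Fin p) ℝ) :
    (scaleDiag Om)ᵀ = scaleDiag Om := diagonal_transpose _

theorem posDef_corrMatrix {Om : Matrix (Fin p) (Fin p) ℝ} (hOm : Om.PosDef) :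
    (corrMatrix Om).PosDef := by
  have hu := scaleDiag_isUnit hOm
  have h : ((scaleDiag Om)⁻¹)ᴴ = (scaleDiag Om)⁻¹ := by
    rw [Matrix.conjTranspose_eq_transpose_of_trivial, Matrix.transpose_nonsing_inv,
      scaleDiag_transpose]
  have hinj : Function.Injective ((scaleDiag Om)⁻¹).mulVec :=
    Matrix.mulVec_injective_of_isUnit ((Matrix.isUnit_nonsing_inv_iff).2
      ((Matrix.isUnit_iff_isUnit_det _).2 hu))
  have := hOm.conjTranspose_mul_mul_same hinj
  rwa [h] at this

theorem dotProduct_location_scale (ξ : Fin p → ℝ) (Om : Matrix (Fin p) (Fin p) ℝ)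
    (d : Fin p → ℝ) (q : ℝ × (Fin p → ℝ)) :
    d ⬝ᵥ (ξ + scaleDiag Om *ᵥ (q.1 • q.2)) =
      q.1 * ((scaleDiag Om *ᵥ d) ⬝ᵥ q.2) + d ⬝ᵥ ξ := by
  rw [dotProduct_add, mulVec_smul, dotProduct_smul, dotProduct_mulVec, ← mulVec_transpose,
    scaleDiag_transpose, smul_eq_mul, add_comm]

section Projection

variable {Ω : Type*} [MeasurableSpace Ω] {Q : Measure Ω} {H : Measure ℝ} {ξ α : Fin p → ℝ} {Om : Matrix (Fin p) (Fin p) ℝ}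
  {X : Ω → Fin p → ℝ}

theorem memLp_projection [IsProbabilityMeasure H] (hOm : Om.PosDef)
    (hX : HasLaw X (smsnMeasure ξ Om α H) Q)
    (h3 : Integrable (fun s => s ^ 3) H) (d : Fin p → ℝ) :
    MemLp (fun w => d ⬝ᵥ X w) 3 Q := by
  have hR := posDef_corrMatrix hOm
  have hprob := (skewNormalMeasure_moments hR α 0).1
  have hd : Measurable fun x : Fin p → ℝ => d ⬝ᵥ x :=
    (continuous_const.dotProduct continuous_id).measurable
  have hm : Measurable fun q : ℝ × (Fin p → ℝ) => ξ + scaleDiag Om *ᵥ (q.1 • q.2) :=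
    (continuous_const.add
      (continuous_const.matrix_mulVec (continuous_fst.smul continuous_snd))).measurable
  have h : MemLp (fun x : Fin p → ℝ => d ⬝ᵥ x) 3 (Q.map X) := by
    rw [hX.map_eq, smsnMeasure, memLp_map_measure_iff hd.aestronglyMeasurable hm.aemeasurable]
    refine ((scaleMixture_memLp hR α (scaleDiag Om *ᵥ d) h3).add
      (memLp_const (d ⬝ᵥ ξ))).ae_eq (Filter.Eventually.of_forall fun q => ?_)
    exact (dotProduct_location_scale ξ Om d q).symm
  exact h.comp_of_map hX.aemeasurable

theorem integral_projection (hX : HasLaw X (smsnMeasure ξ Om α H) Q) (d : Fin p → ℝ)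
    {g : ℝ → ℝ} (hg : Measurable g) :
    ∫ w, g (d ⬝ᵥ X w) ∂Q = ∫ q, g (q.1 * ((scaleDiag Om *ᵥ d) ⬝ᵥ q.2) + d ⬝ᵥ ξ)
      ∂H.prod (skewNormalMeasure (corrMatrix Om) α) := by
  have hd : Measurable fun x : Fin p → ℝ => g (d ⬝ᵥ x) :=
    hg.comp (continuous_const.dotProduct continuous_id).measurable
  have hm : Measurable fun q : ℝ × (Fin p → ℝ) => ξ + scaleDiag Om *ᵥ (q.1 • q.2) :=
    (continuous_const.add
      (continuous_const.matrix_mulVec (continuous_fst.smul continuous_snd))).measurable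
  have h := hX.integral_comp (f := fun x => g (d ⬝ᵥ x)) hd.aestronglyMeasurable
  simp only [Function.comp_def] at h
  rw [h, smsnMeasure, integral_map hm.aemeasurable hd.aestronglyMeasurable]
  simp only [dotProduct_location_scale]

/-- The variance and the third central moment of a projection of a scale mixture of skew-normal
vectors. -/
theorem projection_central_moments [IsProbabilityMeasure H] (hOm : Om.PosDef)
    (hX : HasLaw X (smsnMeasure ξ Om α H) Q)
    (h1 : Integrable (fun s => s) H) (h2 : Integrable (fun s => s ^ 2) H)
    (h3 : Integrable (fun s => s ^ 3) H) (d : Fin p → ℝ) {s1 s2 s3 δ q : ℝ}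
    (hs1 : ∫ s, s ∂H = s1) (hs2 : ∫ s, s ^ 2 ∂H = s2) (hs3 : ∫ s, s ^ 3 ∂H = s3)
    (hδ : projDelta (corrMatrix Om) α (scaleDiag Om *ᵥ d) = δ)
    (hq : (scaleDiag Om *ᵥ d) ⬝ᵥ (corrMatrix Om *ᵥ (scaleDiag Om *ᵥ d)) = q) :
    Var[fun w => d ⬝ᵥ X w; Q] = s2 * q - 2 / Real.pi * s1 ^ 2 * δ ^ 2 ∧
    ∫ w, (d ⬝ᵥ X w - ∫ v, d ⬝ᵥ X v ∂Q) ^ 3 ∂Q = 2 * (√(2 * Real.pi))⁻¹ * δ *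
      (3 * q * (s3 - s1 * s2) + δ ^ 2 * (4 / Real.pi * s1 ^ 3 - s3)) := by
  have hR := posDef_corrMatrix hOm
  obtain ⟨hprob, -, m1, m2, m3⟩ := skewNormalMeasure_moments hR α (scaleDiag Om *ᵥ d)
  rw [hδ] at m1 m3
  rw [hq] at m2 m3
  -- κ = √(2/π), the mean of the absolute value of a standard normal variable.
  set κ := 2 * (√(2 * Real.pi))⁻¹ with hκ
  have hκ2 : κ ^ 2 = 2 / Real.pi := by
    have := Real.pi_pos
    rw [hκ, mul_pow, inv_pow, Real.sq_sqrt (by positivity)]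
    field_simp
  have i1 := scaleMixture_moment hR α (scaleDiag Om *ᵥ d) (k := 1) (by simpa using h1)
  have i2 := scaleMixture_moment hR α (scaleDiag Om *ᵥ d) h2
  have i3 := scaleMixture_moment hR α (scaleDiag Om *ᵥ d) h3
  simp only [pow_one] at i1
  rw [hs1, m1] at i1
  rw [hs2, m2] at i2
  rw [hs3, m3] at i3
  have hmean : ∫ v, d ⬝ᵥ X v ∂Q = s1 * (κ * δ) + d ⬝ᵥ ξ := by
    rw [integral_projection hX d measurable_id (g := fun x => x),
      integral_add i1.1 (integrable_const _), i1.2]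
    simp
  constructor
  · rw [variance_eq_integral (memLp_projection hOm hX h3 d).aemeasurable, hmean,
      integral_projection hX d (g := fun x => (x - (s1 * (κ * δ) + d ⬝ᵥ ξ)) ^ 2) (by fun_prop)]
    simp only [add_sub_add_right_eq_sub]
    rw [integral_sub_pow_two _ i1.1 i2.1 i1.2 i2.2, ← hκ2]
    ring
  · rw [hmean,
      integral_projection hX d (g := fun x => (x - (s1 * (κ * δ) + d ⬝ᵥ ξ)) ^ 3) (by fun_prop)]
    simp only [add_sub_add_right_eq_sub]
    rw [integral_sub_pow_three _ i1.1 i2.1 i3.1 i1.2 i2.2 i3.2,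
      show 4 / Real.pi = 2 * (2 / Real.pi) by ring, ← hκ2]
    ring

theorem dotProduct_covMatrix_mulVec [IsProbabilityMeasure Q] (hX : ∀ i, MemLp (fun w => X w i) 2 Q)
    (d : Fin p → ℝ) :
    d ⬝ᵥ (covMatrix Q X *ᵥ d) = Var[fun w => d ⬝ᵥ X w; Q] := by
  have hm : MemLp (fun w => d ⬝ᵥ X w) 2 Q := memLp_finsetSum _ fun i _ => (hX i).const_mul (d i)
  rw [← covariance_self hm.aemeasurable]
  simp only [dotProduct, mulVec, covMatrix, Matrix.of_apply]
  rw [covariance_fun_sum_fun_sum (fun i => (hX i).const_mul _) (fun i => (hX i).const_mul _)]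
  simp only [covariance_const_mul_left, covariance_const_mul_right, Finset.mul_sum]
  exact Finset.sum_congr rfl fun i _ => Finset.sum_congr rfl fun j _ => by ring

end Projection

end SkewT

/-! ### Cauchy–Schwarz and the maximization -/

namespace SkewT

variable {p : ℕ}

section CauchySchwarz

variable {R : Matrix (Fin p) (Fin p) ℝ}

/-- The R-orthogonal residual of u on α, cleared of denominators. Its nonnegativity is
Cauchy–Schwarz, and its vanishing is the equality case. -/
theorem dotProduct_mulVec_self_residual (hR : R.PosDef) (α u : Fin p → ℝ) :
    ((α ⬝ᵥ (R *ᵥ α)) • u - (u ⬝ᵥ (R *ᵥ α)) • α) ⬝ᵥ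
      (R *ᵥ ((α ⬝ᵥ (R *ᵥ α)) • u - (u ⬝ᵥ (R *ᵥ α)) • α)) =
      (α ⬝ᵥ (R *ᵥ α)) * ((α ⬝ᵥ (R *ᵥ α)) * (u ⬝ᵥ (R *ᵥ u)) - (u ⬝ᵥ (R *ᵥ α)) ^ 2) := by
  have hT : Rᵀ = R := by
    rw [← Matrix.conjTranspose_eq_transpose_of_trivial]
    exact hR.isHermitian
  have hs : α ⬝ᵥ (R *ᵥ u) = u ⬝ᵥ (R *ᵥ α) := by
    rw [dotProduct_mulVec, ← mulVec_transpose, hT, dotProduct_comm]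
  simp only [mulVec_sub, mulVec_smul, dotProduct_sub, sub_dotProduct, dotProduct_smul,
    smul_dotProduct, smul_eq_mul, hs]
  ring

theorem posDef_dotProduct_pos (hR : R.PosDef) {u : Fin p → ℝ} (hu : u ≠ 0) :
    0 < u ⬝ᵥ (R *ᵥ u) := by
  simpa using hR.dotProduct_mulVec_pos hu

theorem posDef_dotProduct_nonneg (hR : R.PosDef) (u : Fin p → ℝ) : 0 ≤ u ⬝ᵥ (R *ᵥ u) := by
  simpa using hR.posSemidef.dotProduct_mulVec_nonneg u

theorem posDef_cauchySchwarz (hR : R.PosDef) (α u : Fin p → ℝ) :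
    (u ⬝ᵥ (R *ᵥ α)) ^ 2 ≤ (α ⬝ᵥ (R *ᵥ α)) * (u ⬝ᵥ (R *ᵥ u)) := by
  rcases eq_or_ne α 0 with rfl | hα
  · simp
  have h := posDef_dotProduct_nonneg hR ((α ⬝ᵥ (R *ᵥ α)) • u - (u ⬝ᵥ (R *ᵥ α)) • α)
  rw [dotProduct_mulVec_self_residual hR] at h
  linarith [nonneg_of_mul_nonneg_right h (posDef_dotProduct_pos hR hα)]

theorem eq_smul_of_posDef_cauchySchwarz_eq (hR : R.PosDef) {α u : Fin p → ℝ} (hα : α ≠ 0)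
    (h : (α ⬝ᵥ (R *ᵥ α)) * (u ⬝ᵥ (R *ᵥ u)) ≤ (u ⬝ᵥ (R *ᵥ α)) ^ 2) :
    ∃ c : ℝ, u = c • α := by
  have hpos := posDef_dotProduct_pos hR hα
  have hv : (α ⬝ᵥ (R *ᵥ α)) • u - (u ⬝ᵥ (R *ᵥ α)) • α = 0 := by
    by_contra hne
    have h' := posDef_dotProduct_pos hR hne
    rw [dotProduct_mulVec_self_residual hR] at h'
    nlinarith
  refine ⟨(u ⬝ᵥ (R *ᵥ α)) / (α ⬝ᵥ (R *ᵥ α)), ?_⟩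
  rw [div_eq_inv_mul, mul_smul, ← sub_eq_zero.1 hv, smul_smul, inv_mul_cancel₀ hpos.ne', one_smul]

theorem projDelta_sq_mul (hR : R.PosDef) (α u : Fin p → ℝ) :
    projDelta R α u ^ 2 * (1 + α ⬝ᵥ (R *ᵥ α)) = (u ⬝ᵥ (R *ᵥ α)) ^ 2 := by
  have h := posDef_dotProduct_nonneg hR α
  rw [projDelta, div_pow, Real.sq_sqrt (by linarith), div_mul_cancel₀]
  linarith

end CauchySchwarz

/-- If `t ↦ κ² t (A + B t)²` describes the squared third moment on the constraint set, then the
squared third moment is a strictly increasing function of `t = δ²`. -/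
theorem third_moment_sq_lt {A B κ t t' : ℝ} (hA : 0 < A) (hB : 0 ≤ B) (hκ : 0 < κ) (ht : 0 ≤ t)
    (h : t < t') : κ ^ 2 * (t * (A + B * t) ^ 2) < κ ^ 2 * (t' * (A + B * t') ^ 2) := by
  have h1 : A + B * t ≤ A + B * t' := by gcongr
  have h2 : 0 < A + B * t := by positivity
  have h3 : (A + B * t) ^ 2 ≤ (A + B * t') ^ 2 := by gcongr
  refine mul_lt_mul_of_pos_left ?_ (by positivity)
  calc t * (A + B * t) ^ 2 < t' * (A + B * t) ^ 2 := mul_lt_mul_of_pos_right h (by positivity)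
    _ ≤ t' * (A + B * t') ^ 2 := mul_le_mul_of_nonneg_left h3 (by linarith)

section Maximal

variable {Ω : Type*} [MeasurableSpace Ω] {Q : Measure Ω}
  {H : Measure ℝ} [IsProbabilityMeasure H] {ξ α : Fin p → ℝ} {Om : Matrix (Fin p) (Fin p) ℝ}
  {X : Ω → Fin p → ℝ} {s1 s2 s3 : ℝ}

theorem memLp_two_coord [IsProbabilityMeasure Q] (hOm : Om.PosDef)
    (hX : HasLaw X (smsnMeasure ξ Om α H) Q)
    (h3 : Integrable (fun s => s ^ 3) H) (i : Fin p) : MemLp (fun w => X w i) 2 Q := by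
  have h := memLp_projection hOm hX h3 (Pi.single i 1)
  simp only [single_dotProduct, one_mul] at h
  exact h.mono_exponent (by norm_num)

theorem scaleDiag_mulVec_ne_zero (hOm : Om.PosDef) {d : Fin p → ℝ} (hd : d ≠ 0) :
    scaleDiag Om *ᵥ d ≠ 0 := by
  intro h
  apply hd
  have := congrArg ((scaleDiag Om)⁻¹ *ᵥ ·) h
  simpa [mulVec_mulVec, Matrix.nonsing_inv_mul _ (scaleDiag_isUnit hOm)] using this

/-- Cauchy–Schwarz gives δ² ≤ q, and (2/π) s1² < s1² ≤ s2, so the subtracted term is smaller than s2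
q. -/
theorem projection_variance_pos (hOm : Om.PosDef) (hX : HasLaw X (smsnMeasure ξ Om α H) Q)
    (h1 : Integrable (fun s => s) H) (h2 : Integrable (fun s => s ^ 2) H)
    (h3 : Integrable (fun s => s ^ 3) H) (hs1 : ∫ s, s ∂H = s1) (hs2 : ∫ s, s ^ 2 ∂H = s2)
    (hs1pos : 0 < s1) (hs12 : s1 ^ 2 ≤ s2) {d : Fin p → ℝ} (hd : d ≠ 0) :
    0 < Var[fun w => d ⬝ᵥ X w; Q] := by
  have hR := posDef_corrMatrix hOm
  rw [(projection_central_moments hOm hX h1 h2 h3 d hs1 hs2 rfl rfl rfl).1]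
  set u := scaleDiag Om *ᵥ d with hu
  have hq := posDef_dotProduct_pos hR (scaleDiag_mulVec_ne_zero hOm hd)
  have hτ := posDef_dotProduct_nonneg hR α
  have hcs := posDef_cauchySchwarz hR α u
  rw [← projDelta_sq_mul hR] at hcs
  rw [← hu] at hq
  set δ := projDelta (corrMatrix Om) α u
  have hδ : δ ^ 2 ≤ u ⬝ᵥ (corrMatrix Om *ᵥ u) := by nlinarith [sq_nonneg δ]
  have hπ : 2 / Real.pi < 1 := by
    rw [div_lt_one Real.pi_pos]
    linarith [Real.pi_gt_three]
  have hπ0 : 0 < 2 / Real.pi := by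
    have := Real.pi_pos
    positivity
  have hs : 0 < s1 ^ 2 := by positivity
  have e1 : 2 / Real.pi * s1 ^ 2 * δ ^ 2 ≤
      2 / Real.pi * s1 ^ 2 * (u ⬝ᵥ (corrMatrix Om *ᵥ u)) := by gcongr
  have e2 : 2 / Real.pi * s1 ^ 2 < s2 := by nlinarith
  nlinarith

theorem posDef_covMatrix [IsProbabilityMeasure Q] (hOm : Om.PosDef)
    (hX : HasLaw X (smsnMeasure ξ Om α H) Q)
    (h1 : Integrable (fun s => s) H) (h2 : Integrable (fun s => s ^ 2) H)
    (h3 : Integrable (fun s => s ^ 3) H) (hs1 : ∫ s, s ∂H = s1) (hs2 : ∫ s, s ^ 2 ∂H = s2)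
    (hs1pos : 0 < s1) (hs12 : s1 ^ 2 ≤ s2) : (covMatrix Q X).PosDef := by
  refine Matrix.PosDef.of_dotProduct_mulVec_pos ?_ fun d hd => ?_
  · ext i j
    simp [covMatrix, covariance_comm]
  · rw [star_trivial, dotProduct_covMatrix_mulVec (memLp_two_coord hOm hX h3)]
    exact projection_variance_pos hOm hX h1 h2 h3 hs1 hs2 hs1pos hs12 hd

/-- Under a moment condition on the mixing law, the maximal-skewness direction of a scale mixture of
skew-normal vectors is that of the shape vector. -/
theorem maxSkewnessDirections_shapeVector [IsProbabilityMeasure Q] (hOm : Om.PosDef)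
    (hX : HasLaw X (smsnMeasure ξ Om α H) Q)
    (h1 : Integrable (fun s => s) H) (h2 : Integrable (fun s => s ^ 2) H)
    (h3 : Integrable (fun s => s ^ 3) H) (hs1 : ∫ s, s ∂H = s1) (hs2 : ∫ s, s ^ 2 ∂H = s2)
    (hs3 : ∫ s, s ^ 3 ∂H = s3) (hs1pos : 0 < s1) (hs12 : s1 ^ 2 ≤ s2) (hs123 : s1 * s2 < s3)
    (hB : 0 ≤ 3 * (2 / Real.pi * s1 ^ 2) * (s3 - s1 * s2) / s2 + (4 / Real.pi * s1 ^ 3 - s3))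
    (hα : α ≠ 0) :
    (∃ c : ℝ, c • shapeVector Om α ∈ maxSkewnessDirections Q X) ∧
      ∀ d ∈ maxSkewnessDirections Q X, ∃ c : ℝ, d = c • shapeVector Om α := by
  have hR := posDef_corrMatrix hOm
  have hX2 := memLp_two_coord hOm hX h3
  have hs2pos : 0 < s2 := lt_of_lt_of_le (by positivity) hs12
  set R := corrMatrix Om
  set D := scaleDiag Om
  set η := shapeVector Om α
  set b := 2 / Real.pi * s1 ^ 2
  set A := 3 * (s3 - s1 * s2) / s2
  set B := 3 * b * (s3 - s1 * s2) / s2 + (4 / Real.pi * s1 ^ 3 - s3)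
  set κ := 2 * (√(2 * Real.pi))⁻¹
  set τ := α ⬝ᵥ (R *ᵥ α)
  have hπ := Real.pi_pos
  have hA : 0 < A := div_pos (by linarith) hs2pos
  have hκ : 0 < κ := by positivity
  have hτ : 0 < τ := posDef_dotProduct_pos hR hα
  have hDη : D *ᵥ η = α := by
    change D *ᵥ (D⁻¹ *ᵥ α) = α
    rw [mulVec_mulVec, Matrix.mul_nonsing_inv _ (scaleDiag_isUnit hOm), one_mulVec]
  have hη : η ≠ 0 := by
    intro h
    rw [h, mulVec_zero] at hDη
    exact hα hDη.symm
  let t : (Fin p → ℝ) → ℝ := fun d => projDelta R α (D *ᵥ d) ^ 2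
  have hmem (d : Fin p → ℝ) : d ∈ unitVarianceDirections (covMatrix Q X) ↔
      Var[fun w => d ⬝ᵥ X w; Q] = 1 := by
    rw [unitVarianceDirections, Set.mem_ofPred_eq, dotProduct_covMatrix_mulVec hX2]
  -- Unit variance determines q as an affine function of t, which leaves t as the only variable.
  have hquad (d : Fin p → ℝ) (hd : d ∈ unitVarianceDirections (covMatrix Q X)) :
      s2 * ((D *ᵥ d) ⬝ᵥ (R *ᵥ (D *ᵥ d))) = 1 + b * t d := by
    rw [hmem, (projection_central_moments hOm hX h1 h2 h3 d hs1 hs2 rfl rfl rfl).1] at hd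
    exact sub_eq_iff_eq_add.1 hd
  have hskew (d : Fin p → ℝ) (hd : d ∈ unitVarianceDirections (covMatrix Q X)) :
      directionalSkewness Q X d = κ ^ 2 * (t d * (A + B * t d) ^ 2) := by
    have hq := hquad d hd
    have hv := (hmem d).1 hd
    rw [directionalSkewness, skewnessIndex, hv]
    simp only [Real.sqrt_one, div_one]
    rw [(projection_central_moments hOm hX h1 h2 h3 d hs1 hs2 hs3 rfl rfl).2]
    have hq' : (D *ᵥ d) ⬝ᵥ (R *ᵥ (D *ᵥ d)) = (1 + b * t d) / s2 := by
      rw [eq_div_iff hs2pos.ne', mul_comm, hq]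
    rw [hq']
    change (κ * _ * (_ + t d * _)) ^ 2 = _
    have e : 3 * ((1 + b * t d) / s2) * (s3 - s1 * s2) + t d * (4 / Real.pi * s1 ^ 3 - s3) =
        A + B * t d := by
      simp only [A, B]
      ring
    rw [e]
    simp only [t]
    ring
  have hbs2 : b < s2 := by
    have hπ1 : 2 / Real.pi < 1 := by
      rw [div_lt_one Real.pi_pos]
      linarith [Real.pi_gt_three]
    have : 0 < s1 ^ 2 := by positivity
    have : b < 1 * s1 ^ 2 := mul_lt_mul_of_pos_right hπ1 this
    linarith
  have hK : 0 < s2 * (1 + τ) - b * τ := by nlinarith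
  -- Cauchy–Schwarz reads t (1 + τ) ≤ τ q; multiply by s2 and substitute the constraint.
  have hbound (d : Fin p → ℝ) (hd : d ∈ unitVarianceDirections (covMatrix Q X)) :
      t d * (s2 * (1 + τ) - b * τ) ≤ τ := by
    have hcs := posDef_cauchySchwarz hR α (D *ᵥ d)
    rw [← projDelta_sq_mul hR] at hcs
    have := mul_le_mul_of_nonneg_left hcs hs2pos.le
    rw [mul_left_comm s2 τ, hquad d hd] at this
    change s2 * (t d * (1 + τ)) ≤ _ at this
    linarith
  have hVη := projection_variance_pos hOm hX h1 h2 h3 hs1 hs2 hs1pos hs12 hη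
  set v := Var[fun w => η ⬝ᵥ X w; Q]
  set c := (√v)⁻¹
  have hcη : c • η ∈ unitVarianceDirections (covMatrix Q X) := by
    rw [hmem]
    simp only [smul_dotProduct, smul_eq_mul]
    rw [variance_const_mul]
    change c ^ 2 * v = 1
    rw [inv_pow, Real.sq_sqrt hVη.le, inv_mul_cancel₀ hVη.ne']
  -- Since D η = α, Cauchy–Schwarz is an equality at c • η, so the bound on t is attained.
  have hteq : t (c • η) * (s2 * (1 + τ) - b * τ) = τ := by
    have h := hquad _ hcη
    have hδ := projDelta_sq_mul hR α (D *ᵥ (c • η))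
    change t (c • η) * (1 + τ) = _ at hδ
    rw [mulVec_smul, hDη, smul_dotProduct, smul_eq_mul] at hδ
    rw [mulVec_smul, hDη, mulVec_smul, dotProduct_smul, smul_dotProduct, smul_eq_mul,
      smul_eq_mul] at h
    change t (c • η) * (1 + τ) = (c * τ) ^ 2 at hδ
    change s2 * (c * (c * τ)) = _ at h
    linear_combination s2 * hδ + τ * h
  have hle (d : Fin p → ℝ) (hd : d ∈ unitVarianceDirections (covMatrix Q X)) :
      t d ≤ t (c • η) :=
    le_of_mul_le_mul_right ((hbound d hd).trans_eq hteq.symm) hK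
  refine ⟨⟨c, hcη, fun d hd => ?_⟩, fun d hd => ?_⟩
  · rw [Set.mem_ofPred_eq, hskew d hd, hskew _ hcη]
    rcases (hle d hd).eq_or_lt with h | h
    · rw [h]
    · exact (third_moment_sq_lt hA hB hκ (sq_nonneg _) h).le
  · have hmax := hd.2 hcη
    rw [Set.mem_ofPred_eq, hskew d hd.1, hskew _ hcη] at hmax
    have htd : t (c • η) ≤ t d := by
      by_contra hlt
      exact absurd hmax (not_le.2 (third_moment_sq_lt hA hB hκ (sq_nonneg _) (not_le.1 hlt)))
    -- A maximizer also attains the bound, which forces equality in Cauchy–Schwarz and so D d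
    -- parallel to α.
    have hge : τ ≤ t d * (s2 * (1 + τ) - b * τ) :=
      hteq.symm.le.trans (mul_le_mul_of_nonneg_right htd hK.le)
    obtain ⟨r, hr⟩ := eq_smul_of_posDef_cauchySchwarz_eq hR hα (u := D *ᵥ d) (by
      rw [← projDelta_sq_mul hR]
      refine le_of_mul_le_mul_left ?_ hs2pos
      rw [mul_left_comm s2, hquad d hd.1]
      change _ ≤ s2 * (t d * (1 + τ))
      linarith)
    refine ⟨r, ?_⟩
    change d = r • (D⁻¹ *ᵥ α)
    rw [← mulVec_smul, ← hr, mulVec_mulVec, Matrix.nonsing_inv_mul _ (scaleDiag_isUnit hOm),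
      one_mulVec]

end Maximal

end SkewT

end

/-! ### Assembly for the skew-t law -/

theorem mainTheorem4
    {Ω₁ : Type*} [MeasurableSpace Ω₁] (P : Measure Ω₁) [IsProbabilityMeasure P]
    (ν : ℝ) (hν : 3 < ν) (V S : Ω₁ → ℝ)
    (hV : HasLaw V ((SkewT.chiSquaredMeasure ν).map fun x => x / ν) P)
    (hS : S = fun w => V w ^ (-(1 / 2) : ℝ))
    {Ω₂ : Type*} [MeasurableSpace Ω₂] (Q : Measure Ω₂) [IsProbabilityMeasure Q]
    (p : ℕ) (ξ : Fin p → ℝ) (Om : Matrix (Fin p) (Fin p) ℝ) (hOm : Om.PosDef) (α : Fin p → ℝ)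
    (X : Ω₂ → Fin p → ℝ) (hX : HasLaw X (SkewT.smsnMeasure ξ Om α (P.map S)) Q) :
    -- the moments of the mixing variable
    (∀ k : ℕ, 1 ≤ k → (k : ℝ) < ν →
      Integrable (fun w => S w ^ k) P ∧
      ∫ w, S w ^ k ∂P =
        (ν / 2) ^ ((k : ℝ) / 2) * Real.Gamma ((ν - k) / 2) / Real.Gamma (ν / 2)) ∧
    -- the moment condition
    (4 ≤ ν → (4 / Real.pi) * (∫ w, S w ∂P) ^ 2 ≥ ∫ w, S w ^ 2 ∂P) ∧
    -- the closed form of `a = (4/π) E(S)³ - E(S³)` and its sign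
    ((4 / Real.pi) * (∫ w, S w ∂P) ^ 3 - ∫ w, S w ^ 3 ∂P =
      ν * (∫ w, S w ∂P) *
        (2 / Real.pi * (Real.Gamma ((ν - 1) / 2) ^ 2 / Real.Gamma (ν / 2) ^ 2) - 1 / (ν - 3))) ∧
    (ν ≤ 8 → (4 / Real.pi) * (∫ w, S w ∂P) ^ 3 - ∫ w, S w ^ 3 ∂P < 0) ∧
    (9 ≤ ν → (4 / Real.pi) * (∫ w, S w ∂P) ^ 3 - ∫ w, S w ^ 3 ∂P > 0) ∧
    -- the skewness problem is well posed
    (∀ d : Fin p → ℝ, MemLp (fun w => d ⬝ᵥ X w) 3 Q) ∧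
    (SkewT.covMatrix Q X).PosDef ∧
    -- the maximal skewness is attained exactly at the direction of the shape vector
    (α ≠ 0 →
      (∃ c : ℝ, c • SkewT.shapeVector Om α ∈ SkewT.maxSkewnessDirections Q X) ∧
      ∀ d ∈ SkewT.maxSkewnessDirections Q X, ∃ c : ℝ, d = c • SkewT.shapeVector Om α) := by
  have hν0 : 0 < ν := by linarith
  have hπ := Real.pi_pos
  have hmom (k : ℕ) (hk : (k : ℝ) < ν) := SkewT.moment_rpow_neg_half hν hV k hk
  have hs1 := SkewT.integral_rpow_neg_half_pos hν hV
  have hs1sq := SkewT.sq_integral_rpow_neg_half hν hV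
  have hs2 := SkewT.integral_rpow_neg_half_sq hν hV
  have hs3 := SkewT.integral_rpow_neg_half_cube hν hV
  have hSm : AEMeasurable S P := by
    rw [hS]
    exact hV.aemeasurable.pow_const _
  simp_rw [← show ∀ w, S w = V w ^ (-(1 / 2) : ℝ) from fun w => congrFun hS w]
    at hmom hs1 hs1sq hs2 hs3
  set s1 := ∫ w, S w ∂P
  set G := SkewT.gammaRatioSq (ν / 2)
  have hν2 : 0 < ν - 2 := by linarith
  have hν3 : 0 < ν - 3 := by linarith
  have hcubic : (4 / Real.pi) * s1 ^ 3 - ∫ w, S w ^ 3 ∂P =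
      ν * s1 * (2 / Real.pi * G - 1 / (ν - 3)) := by
    rw [hs3, show s1 ^ 3 = s1 * s1 ^ 2 by ring, hs1sq]
    ring
  have hGsign : 2 / Real.pi * G - 1 / (ν - 3) =
      4 / Real.pi / (ν - 3) * ((ν / 2 - 3 / 2) * G - Real.pi / 4) := by
    field_simp
    ring
  have hcoef : 0 < 4 / Real.pi / (ν - 3) := by positivity
  have hνs1 : 0 < ν * s1 := by positivity
  have hprob : IsProbabilityMeasure (P.map S) := Measure.isProbabilityMeasure_map hSm
  have hint (k : ℕ) (hk : (k : ℝ) < ν) : Integrable (fun s => s ^ k) (P.map S) := by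
    rw [integrable_map_measure (by fun_prop) hSm]
    exact (hmom k hk).1
  have hval (k : ℕ) : ∫ s, s ^ k ∂P.map S = ∫ w, S w ^ k ∂P :=
    integral_map hSm (by fun_prop)
  have h1 : Integrable (fun s => s) (P.map S) := by
    simpa using hint 1 (by norm_num; linarith)
  have h2 := hint 2 (by norm_num; linarith)
  have h3 := hint 3 (by norm_num; linarith)
  have hv1 : ∫ s, s ∂P.map S = s1 := by simpa using hval 1
  have hv2 := (hval 2).trans hs2
  have hv3 := (hval 3).trans hs3
  have hs12 : s1 ^ 2 ≤ ν / (ν - 2) := by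
    have h := SkewT.gammaRatioSq_le (x := ν / 2) (by linarith)
    rw [hs1sq]
    calc ν / 2 * G ≤ ν / 2 * (1 / (ν / 2 - 1)) := by gcongr
      _ = ν / (ν - 2) := by field_simp
  have hs123 : s1 * (ν / (ν - 2)) < ν / (ν - 3) * s1 := by
    rw [mul_comm]
    gcongr
    linarith
  refine ⟨fun k _ hk => hmom k hk, fun h4 => ?_, ?_, fun h8 => ?_, fun h9 => ?_,
    fun d => SkewT.memLp_projection hOm hX h3 d,
    SkewT.posDef_covMatrix hOm hX h1 h2 h3 hv1 hv2 hs1 hs12,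
    fun hα => SkewT.maxSkewnessDirections_shapeVector hOm hX h1 h2 h3 hv1 hv2 hv3 hs1 hs12 hs123
      ?_ hα⟩
  · have h := SkewT.pi_div_four_le_sub_one_mul_gammaRatioSq (x := ν / 2) (by linarith)
    rw [ge_iff_le, hs2, hs1sq, div_le_iff₀ hν2]
    calc ν = 4 * ν / Real.pi * (Real.pi / 4) := by field_simp
      _ ≤ 4 * ν / Real.pi * ((ν / 2 - 1) * G) := by gcongr
      _ = 4 / Real.pi * (ν / 2 * G) * (ν - 2) := by ring
  · rw [hcubic, show (ν - 1) / 2 = ν / 2 - 1 / 2 by ring]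
    rfl
  · have h := SkewT.sub_three_halves_mul_gammaRatioSq_lt (x := ν / 2) (by linarith) (by linarith)
    rw [hcubic, hGsign]
    exact mul_neg_of_pos_of_neg hνs1 (mul_neg_of_pos_of_neg hcoef (sub_neg.2 h))
  · have h := SkewT.pi_div_four_lt_sub_three_halves_mul_gammaRatioSq (x := ν / 2) (by linarith)
    rw [hcubic, hGsign]
    exact mul_pos hνs1 (mul_pos hcoef (sub_pos.2 h))
  · have h := SkewT.pi_lt_mul_gammaRatioSq (x := ν / 2) (by linarith)
    -- Here (s3 - s1 s2)/s2 = s1/(ν - 3), so B is a positive multiple of (2ν - 3) G - π.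
    have e : 3 * (2 / Real.pi * s1 ^ 2) * (ν / (ν - 3) * s1 - s1 * (ν / (ν - 2))) / (ν / (ν - 2)) +
        (4 / Real.pi * s1 ^ 3 - ν / (ν - 3) * s1) =
        ν * s1 / (Real.pi * (ν - 3)) * ((4 * (ν / 2) - 3) * G - Real.pi) := by
      rw [show s1 ^ 3 = s1 * s1 ^ 2 by ring, hs1sq]
      field_simp
      ring
    rw [e]
    have : 0 < ν * s1 / (Real.pi * (ν - 3)) := by positivity
    exact (mul_pos this (sub_pos.2 h)).le
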